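/- **Theorem (Max-$k$-CSP has a complete, compressed and efficiently optimizable solution generator).** *Setting.* An instance of Max-$k$-CSP on $n$ variables is a finite set $P$ of predicates $h:\{-1,1\}^n\to\{0,1\}$, each depending on at most $k$ variables; the cost of $s\in\{-1,1\}^n$ is $L(s;P)=-|\{h\in P: h(s)=1\}|$. Let $d=|\{S\subseteq[n]:|S|\le k\}|$, let $\psi_S(s)=s^{\otimes k}:=(\prod_{u\in S}s_u)_{|S|\le k}\in\mathbb R^d$ be the solution features, and let $\psi_{\mathcal I}(P)=-\sum_{h\in P}(\widehat h(S))_{|S|\le k}\in\mathbb R^d$ be the instance features, where $\widehat h(S)=\mathbf E_{x\sim U(\{-1,1\}^n)}[h(x)\prod_{u\in S}x_u]$. For $w\in\mathbb R^d$ let $$\phi(s;P;w)\propto\exp\big(\psi_{\mathcal I}(P)^\top\mathrm{diag}(w)\,\psi_S(s)\big),\qquad p(s;P;w)=(1-\beta)\,\phi(s;P;w)+\beta\,\phi(s;P;\rho w),$$ probability distributions over $s\in\{-1,1\}^n$. For a prior $\mathcal R$ over instances put $\mathcal L(w)=\mathbf E_{P\sim\mathcal R}\mathbf E_{s\sim p(\cdot;P;w)}[L(s;P)]$,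 $\mathrm{opt}=\mathbf E_{P\sim\mathcal R}[\min_sL(s;P)]$, $H(w)=\mathbf E_{P\sim\mathcal R}\mathbf E_{s\sim\phi(\cdot;P;w)}[\log\phi(s;P;w)]$, $R(w)=(1-\beta)H(w)+\frac{\beta}{\rho}H(\rho w)$ and $\mathcal L_\lambda=\mathcal L+\lambda R$. The parameter space is $\mathcal W=\{w\in\mathbb R^d:\|w\|_2\le\sqrt d/\lambda\}$. *Projected SGD* with step size $\eta$, started at $W_0\in\mathcal W$, is $W_{t+1}=\Pi_{\mathcal W}(W_t-\eta g_t)$, where $\Pi_{\mathcal W}$ is the Euclidean projection. Here $g_t$ is computed from one fresh sample: draw $P\sim\mathcal R$; with probability $1-\beta$ draw $s\sim\phi(\cdot;P;W_t)$ and let $g_t=\big(L(s;P)+\lambda\log\phi(s;P;W_t)\big)\nabla_w\log\phi(s;P;w)|_{w=W_t}$; with probability $\beta$ draw $s\sim\phi(\cdot;P;\rho W_t)$ and let $g_t=\big(L(s;P)+\frac\lambda\rho\log\phi(s;P;\rho W_t)\big)\nabla_w\log\phi(s;P;\rho w)|_{w=W_t}$. *Claims.* (a) For all $n,k$, $P$,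 $s$: $L(s;P)=\psi_{\mathcal I}(P)^\top I\,\psi_S(s)$, with $I$ the identity matrix. (b) For all $n,k$ and $v\in\mathbb R^d$: $\mathrm{Var}_{s\sim U(\{-1,1\}^n)}[v\cdot\psi_S(s)]=\sum_{S\ne\emptyset,\,|S|\le k}v_S^2$. (c) There is an absolute constant $c\in\mathbb N$, and for each $k\in\mathbb N$ a constant $C=C(k)>0$, such that for all $n\ge1$ and $\varepsilon>0$ there are $\lambda=2^{-i}$, $\beta=2^{-j}$, $\rho=2^{-l}$ (with integers $i\ge 0$, $j,l\ge1$ and $i+j+l\le C\log_2(n^k(2+1/\varepsilon))$), a step size $\eta>0$ and a point $\overline w\in\mathcal W$ with the following properties. 1. *Compressed.* The number of parameters is $d\le Cn^k$. For every $\delta\in(0,1]$, some $b\le Cn^k\log_2(2/\delta)$ bits suffice to identify every element of $\mathcal W$ with error at most $\delta/\lambda$ in each coordinate (relative precision $\delta$), and $\overline w$ exactly: there is a map $\{0,1\}^b\to\mathcal W$ with $\overline w$ in its range whose range comes that close to every element of $\mathcal W$. In particular, at relative precision $\delta=\min(1,\varepsilon)$ the description size is $O(n^k)\,\mathrm{polylog}(1/\varepsilon)$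 (for $\varepsilon \le 1/2$). Moreover, for every prior $\mathcal R$ over instances: 2. For every $\delta\ge0$ and all $w,v\in\mathcal W$ with $|w_S-v_S|\le\delta/\lambda$ for every $S$: $|\mathcal L(w)-\mathcal L(v)|\le C\,(n^k(1+1/\varepsilon))^c\,\delta$. 3. *Unbiased estimator.* For every $w\in\mathbb R^d$, $\mathcal L_\lambda$ is differentiable at $w$, and its gradient is the expectation of the estimator of projected SGD at $w$. 4. *Complete.* $\mathcal L(\overline w)\le\mathrm{opt}+\varepsilon$, and $\overline w$ minimizes $\mathcal L_\lambda$ over $\mathcal W$. 5. *Efficiently optimizable.* For every $W_0\in\mathcal W$ and every integer $T\ge C\,(n^k(1+1/\varepsilon))^c$, the iterates of projected SGD satisfy $$\mathbf E_{t\sim U(\{1,\dots,T\})}\mathbf E[\mathcal L(W_t)]\le\mathcal L(\overline w)+\varepsilon,\qquad \mathbf E_{t\sim U(\{1,\dots,T\})}\mathbf E[\mathcal L_\lambda(W_t)]\le\mathcal L_\lambda(\overline w)+\varepsilon .$$ -/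

import Mathlib

namespace MaxKCSP

open scoped BigOperators Matrix

noncomputable section

/-- The Boolean cube `{-1, 1}ⁿ`: assignments to the variables, which are the solutions. -/
abbrev Cube (n : ℕ) : Type := Fin n → ℤˣ

/-- Boolean predicates on `{-1, 1}ⁿ` that depend on at most `k` of the variables. -/
def Predicate (n k : ℕ) : Type :=
  {h : Cube n → Bool // ∃ J : Finset (Fin n), J.card ≤ k ∧ DependsOn h (J : Set (Fin n))}

instance (n k : ℕ) : Finite (Predicate n k) := by
  unfold Predicate; infer_instance

instance (n k : ℕ) : Fintype (Predicate n k) := Fintype.ofFinite _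

/-- An instance of Max-`k`-CSP: a finite set of predicates. -/
abbrev Instance (n k : ℕ) : Type := Finset (Predicate n k)

/-- The cost of an assignment: minus the number of satisfied predicates. -/
def cost {n k : ℕ} (P : Instance n k) (s : Cube n) : ℝ :=
  -(((P.filter fun h => h.1 s = true).card : ℕ) : ℝ)

/-! ### Fourier analysis and features -/

/-- Expectation under the uniform distribution on the cube. -/
def cubeMean {n : ℕ} (f : Cube n → ℝ) : ℝ := (∑ x, f x) / 2 ^ n

/-- Variance under the uniform distribution on the cube. -/
def cubeVar {n : ℕ} (f : Cube n → ℝ) : ℝ := cubeMean fun x => (f x - cubeMean f) ^ 2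

/-- The monomial `∏_{u ∈ S} x_u`. -/
def chi {n : ℕ} (S : Finset (Fin n)) (x : Cube n) : ℝ := ∏ u ∈ S, (((x u : ℤˣ) : ℤ) : ℝ)

/-- The Fourier coefficient of a `{0,1}`-valued function at `S`. -/
def fourierCoeff {n : ℕ} (h : Cube n → Bool) (S : Finset (Fin n)) : ℝ :=
  cubeMean fun x => (if h x = true then 1 else 0) * chi S x

/-- Feature coordinates: the sets of at most `k` variables. -/
abbrev Idx (n k : ℕ) : Type := {S : Finset (Fin n) // S.card ≤ k}

/-- Solution features: the vector of all monomials of degree at most `k`. -/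
def solFeature {n : ℕ} (k : ℕ) (s : Cube n) : Idx n k → ℝ := fun S => chi S.1 s

/-- Instance features: minus the coordinatewise sum of the Fourier coefficients. -/
def instFeature {n k : ℕ} (P : Instance n k) : Idx n k → ℝ :=
  fun S => -∑ h ∈ P, fourierCoeff h.1 S.1

/-! ### The solution generators -/

/-- Parameter vectors `w`; they parametrize the diagonal matrices `W = diag w`. -/
abbrev Param (n k : ℕ) : Type := EuclideanSpace ℝ (Idx n k)

/-- The bilinear form `zᵀ W x` for `W = diag w`, where `z`, `x` are the features of `P`, `s`. -/
def energy {n k : ℕ} (P : Instance n k) (w : Param n k) (s : Cube n) : ℝ :=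
  instFeature P ⬝ᵥ (Matrix.diagonal (fun S => w S) *ᵥ solFeature k s)

/-- The exponential family `φ(s; P; w) ∝ exp (zᵀ W x)`, a probability mass function in `s`. -/
def phi {n k : ℕ} (P : Instance n k) (w : Param n k) (s : Cube n) : ℝ :=
  Real.exp (energy P w s) / ∑ y, Real.exp (energy P w y)

/-- The mixture `p(s; P; w) = (1 - β) φ(s; P; w) + β φ(s; P; ρ w)`. -/
def generator {n k : ℕ} (β ρ : ℝ) (P : Instance n k) (w : Param n k) (s : Cube n) : ℝ :=
  (1 - β) * phi P w s + β * phi P (ρ • w) s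

/-- Expectation over an instance drawn from the prior. -/
def priorMean {n k : ℕ} (R : PMF (Instance n k)) (f : Instance n k → ℝ) : ℝ :=
  ∑ P, (R P).toReal * f P

/-- The loss: expected cost of a solution drawn from the generator. -/
def loss {n k : ℕ} (β ρ : ℝ) (R : PMF (Instance n k)) (w : Param n k) : ℝ :=
  priorMean R fun P => ∑ s, generator β ρ P w s * cost P s

/-- The expected optimal cost. -/
def opt {n k : ℕ} (R : PMF (Instance n k)) : ℝ := priorMean R fun P => ⨅ s, cost P s

/-- The negative entropy `H`. -/
def negEntropy {n k : ℕ} (R : PMF (Instance n k)) (w : Param n k) : ℝ :=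
  priorMean R fun P => ∑ s, phi P w s * Real.log (phi P w s)

/-- The regularizer. -/
def regularizer {n k : ℕ} (β ρ : ℝ) (R : PMF (Instance n k)) (w : Param n k) : ℝ :=
  (1 - β) * negEntropy R w + β / ρ * negEntropy R (ρ • w)

/-- The regularized loss. -/
def regLoss {n k : ℕ} (lam β ρ : ℝ) (R : PMF (Instance n k)) (w : Param n k) : ℝ :=
  loss β ρ R w + lam * regularizer β ρ R w

/-- The radius `‖M‖_F / lam` of the parameter space, where `M` is the identity matrix. -/
def radius (n k : ℕ) (lam : ℝ) : ℝ := √(Fintype.card (Idx n k) : ℝ) / lam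

/-- The parameter space: a ball centred at the origin. -/
def paramSpace (n k : ℕ) (lam : ℝ) : Set (Param n k) := Metric.closedBall 0 (radius n k lam)

/-- `b` bits identify every element of `A` up to an error `δ` in each coordinate, and the point
`a` exactly: some decoder sends the `b`-bit strings into `A`, has `a` among its values, and comes
that close to each element of `A`. -/
def Describable {n k : ℕ} (A : Set (Param n k)) (a : Param n k) (δ : ℝ) (b : ℕ) : Prop :=
  ∃ decode : (Fin b → Bool) → Param n k,
    (∀ x, decode x ∈ A) ∧ (∃ x, decode x = a) ∧ ∀ w ∈ A, ∃ x, ∀ S, |w S - decode x S| ≤ δ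

/-! ### Projected stochastic gradient descent -/

/-- What one step of SGD draws: an instance, a component of the mixture
(`true` is the component with parameter `ρ w`), and a solution. -/
abbrev Sample (n k : ℕ) : Type := Instance n k × Bool × Cube n

/-- The probability of a sample at parameter `w`: the instance is drawn from the prior, the
component has probabilities `1 - β`, `β`, and the solution is drawn from that component. -/
def sampleProb {n k : ℕ} (β ρ : ℝ) (R : PMF (Instance n k)) (w : Param n k) :
    Sample n k → ℝ
  | (P, false, s) => (R P).toReal * ((1 - β) * phi P w s)
  | (P, true, s) => (R P).toReal * (β * phi P (ρ • w) s)

/-- The policy-gradient estimator of the gradient of the regularized loss from one sample. -/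
def sgdGrad {n k : ℕ} (lam ρ : ℝ) (w : Param n k) : Sample n k → Param n k
  | (P, false, s) =>
      (cost P s + lam * Real.log (phi P w s)) • gradient (fun v => Real.log (phi P v s)) w
  | (P, true, s) =>
      (cost P s + lam / ρ * Real.log (phi P (ρ • w) s)) •
        gradient (fun v => Real.log (phi P (ρ • v) s)) w

/-- Euclidean projection to the ball of radius `r` centred at the origin. -/
def projBall {n k : ℕ} (r : ℝ) (w : Param n k) : Param n k :=
  if ‖w‖ ≤ r then w else (r / ‖w‖) • w

/-- One step of projected SGD with step size `η`. -/
def sgdStep {n k : ℕ} (lam ρ η : ℝ) (w : Param n k) (ξ : Sample n k) : Param n k :=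
  projBall (radius n k lam) (w - η • sgdGrad lam ρ w ξ)

/-- `sgdMean … f t w` is the expectation of `f (W_t)` for the iterate `W_t` after `t` steps of
projected SGD from `W_0 = w` (by conditioning on the sample drawn in the first step). -/
def sgdMean {n k : ℕ} (lam β ρ η : ℝ) (R : PMF (Instance n k)) (f : Param n k → ℝ) :
    ℕ → Param n k → ℝ
  | 0, w => f w
  | t + 1, w => ∑ ξ, sampleProb β ρ R w ξ * sgdMean lam β ρ η R f t (sgdStep lam ρ η w ξ)

/-- The expectation of `f (W_t)` when also `t` is uniform in `{1, …, T}`. -/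
def sgdAverage {n k : ℕ} (lam β ρ η : ℝ) (R : PMF (Instance n k)) (f : Param n k → ℝ)
    (T : ℕ) (w : Param n k) : ℝ :=
  (∑ t ∈ Finset.Icc 1 T, sgdMean lam β ρ η R f t w) / T

end

end MaxKCSP

/-! A predicate on at most `k` variables is a multilinear polynomial of degree at most `k`, so the
cost is linear in the monomials, with the instance features as coefficients. Hence the constant
vector `-1 / lam` (`refParam`), of norm exactly `√d / lam`, makes `φ` the Gibbs distribution of the
cost at temperature `lam`, whatever the instance. This is the point `wbar`. For small `lam` and `β`
its loss is nearly optimal: the Gibbs mean exceeds the minimum by at most `lam log 2ⁿ`, and the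
second component costs at most `2βM`, with `M` the number of predicates.

On one instance, the regularized loss of the component with scale `r` is a free energy at
temperature `lam / r`. Its excess over `wbar` is `lam / r` times a relative entropy
(`componentLoss_sub_refParam`), so `wbar` minimizes both components on all instances at once.

Convexity is not used for SGD. The gradient paired with `w - wbar` (`drift`) is an average of terms
`lam * r * Var`, the variance being that of the energy of `w - wbar` under the component
(`inner_sum_componentGrad`). At scale `ρ` the exponents are at most 1, so this Gibbs variance
dominates, up to a factor 8, the variance under uniform solutions (`mul_meanVar_le_drift`).
Conversely, Fourier orthogonality and Cauchy-Schwarz bound the energy, modulo a constant, by `√(d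
Var)` uniformly. This bounds relative entropies and differences of mean cost, hence the excess of
both losses, by the uniform variance (`regLoss_le_add_meanVar`, `loss_le_add_meanVar`). So the drift
dominates the excess losses, up to `ε / 2` for the unregularized one, and the usual telescoping of
`‖W_t - wbar‖²` applies (`sgdAverage_le`). All losses in this chain are polynomial in `K = 1 / lam`.

For the bit count, the ball has ℓ¹-radius at most `d / lam`; counting grid points under this ℓ¹
budget gives `(12 / δ)^d`, with no factor `log d` in the exponent. -/

namespace MaxKCSP

open scoped BigOperators Matrix

noncomputable section

/-! ### Gibbs distributions on finite types -/

section Gibbs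

variable {X : Type*} [Fintype X]

/-- The Gibbs distribution with exponent `e`. -/
def gibbs (e : X → ℝ) (s : X) : ℝ := Real.exp (e s) / ∑ y, Real.exp (e y)

/-- Expectation under a Gibbs distribution. -/
def gibbsMean (e f : X → ℝ) : ℝ := ∑ s, gibbs e s * f s

/-- Variance under a Gibbs distribution. -/
def gibbsVar (e f : X → ℝ) : ℝ := gibbsMean e fun s => (f s - gibbsMean e f) ^ 2

/-- Relative entropy of two Gibbs distributions. -/
def gibbsKL (e₁ e₂ : X → ℝ) : ℝ :=
  gibbsMean e₁ fun s => Real.log (gibbs e₁ s) - Real.log (gibbs e₂ s)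

lemma gibbsMean_add (e f g : X → ℝ) :
    gibbsMean e (fun s => f s + g s) = gibbsMean e f + gibbsMean e g := by
  simp [gibbsMean, mul_add, Finset.sum_add_distrib]

lemma gibbsMean_sub (e f g : X → ℝ) :
    gibbsMean e (fun s => f s - g s) = gibbsMean e f - gibbsMean e g := by
  simp [gibbsMean, mul_sub, Finset.sum_sub_distrib]

lemma gibbsMean_const_mul (e : X → ℝ) (a : ℝ) (f : X → ℝ) :
    gibbsMean e (fun s => a * f s) = a * gibbsMean e f := by
  simp only [gibbsMean, Finset.mul_sum]
  exact Finset.sum_congr rfl fun s _ => by ring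

variable [Nonempty X]

lemma sum_exp_pos (e : X → ℝ) : 0 < ∑ y, Real.exp (e y) :=
  Finset.sum_pos (fun _ _ => Real.exp_pos _) Finset.univ_nonempty

lemma gibbs_pos (e : X → ℝ) (s : X) : 0 < gibbs e s :=
  div_pos (Real.exp_pos _) (sum_exp_pos e)

lemma sum_gibbs (e : X → ℝ) : ∑ s, gibbs e s = 1 := by
  simp only [gibbs, ← Finset.sum_div]
  exact div_self (sum_exp_pos e).ne'

lemma gibbs_le_one (e : X → ℝ) (s : X) : gibbs e s ≤ 1 := by
  rw [← sum_gibbs e]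
  exact Finset.single_le_sum (fun y _ => (gibbs_pos e y).le) (Finset.mem_univ s)

lemma log_gibbs (e : X → ℝ) (s : X) :
    Real.log (gibbs e s) = e s - Real.log (∑ y, Real.exp (e y)) := by
  rw [gibbs, Real.log_div (Real.exp_ne_zero _) (sum_exp_pos e).ne', Real.log_exp]

lemma gibbsMean_const (e : X → ℝ) (a : ℝ) : gibbsMean e (fun _ => a) = a := by
  rw [gibbsMean, ← Finset.sum_mul, sum_gibbs, one_mul]

lemma gibbsMean_mono (e : X → ℝ) {f g : X → ℝ} (h : ∀ s, f s ≤ g s) :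
    gibbsMean e f ≤ gibbsMean e g :=
  Finset.sum_le_sum fun s _ => mul_le_mul_of_nonneg_left (h s) (gibbs_pos e s).le

lemma gibbsMean_nonneg (e : X → ℝ) {f : X → ℝ} (h : ∀ s, 0 ≤ f s) : 0 ≤ gibbsMean e f :=
  Finset.sum_nonneg fun s _ => mul_nonneg (gibbs_pos e s).le (h s)

lemma gibbsVar_nonneg (e f : X → ℝ) : 0 ≤ gibbsVar e f :=
  gibbsMean_nonneg e fun _ => sq_nonneg _

/-- The numerator gains at most `exp (a + τ)` and the partition function at least `exp (a - τ)`; the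
shift `a` cancels in the quotient. -/
lemma gibbs_le_exp_mul {e₁ e₂ : X → ℝ} {a τ : ℝ} (h : ∀ s, |e₁ s - e₂ s - a| ≤ τ) (s : X) :
    gibbs e₁ s ≤ Real.exp (2 * τ) * gibbs e₂ s := by
  have h1 : Real.exp (e₁ s) ≤ Real.exp (a + τ) * Real.exp (e₂ s) := by
    rw [← Real.exp_add]
    exact Real.exp_le_exp.2 (by linarith [(abs_le.1 (h s)).2])
  have h2 : Real.exp (a - τ) * ∑ y, Real.exp (e₂ y) ≤ ∑ y, Real.exp (e₁ y) := by
    rw [Finset.mul_sum]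
    refine Finset.sum_le_sum fun y _ => ?_
    rw [← Real.exp_add]
    exact Real.exp_le_exp.2 (by linarith [(abs_le.1 (h y)).1])
  have h3 : Real.exp (2 * τ) * Real.exp (a - τ) = Real.exp (a + τ) := by
    rw [← Real.exp_add]; ring_nf
  have hZ := sum_exp_pos e₂
  rw [gibbs, gibbs, div_le_iff₀ (sum_exp_pos e₁)]
  calc Real.exp (e₁ s) ≤ Real.exp (2 * τ) * (Real.exp (e₂ s) / ∑ y, Real.exp (e₂ y)) *
        (Real.exp (a - τ) * ∑ y, Real.exp (e₂ y)) := by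
        rw [← h3] at h1
        convert h1 using 1
        field_simp
    _ ≤ _ := by
        refine mul_le_mul_of_nonneg_left h2 ?_
        positivity

lemma sum_abs_gibbs_sub_le {e₁ e₂ : X → ℝ} {a τ : ℝ} (h : ∀ s, |e₁ s - e₂ s - a| ≤ τ) :
    ∑ s, |gibbs e₁ s - gibbs e₂ s| ≤ 4 * τ := by
  have hτ : 0 ≤ τ := (abs_nonneg _).trans (h (Classical.arbitrary X))
  have h' : ∀ s, |e₂ s - e₁ s - -a| ≤ τ := fun s => by
    rw [← abs_neg]; convert h s using 2; ring
  -- For small `τ` the pointwise ratio bound and `exp x - 1 ≤ 2x` on `[0, 1]` suffice; otherwise the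
  -- trivial bound 2 is already below `4τ`.
  rcases le_total (2 * τ) 1 with h1 | h1
  · have hexp : Real.exp (2 * τ) - 1 ≤ 4 * τ := by
      have := Real.abs_exp_sub_one_le (x := 2 * τ) (by rw [abs_of_nonneg (by linarith)]; exact h1)
      rw [abs_of_nonneg (by linarith : (0 : ℝ) ≤ 2 * τ)] at this
      linarith [le_abs_self (Real.exp (2 * τ) - 1)]
    have hone : 1 ≤ Real.exp (2 * τ) := Real.one_le_exp (by linarith)
    have key : ∀ s, |gibbs e₁ s - gibbs e₂ s| ≤ (Real.exp (2 * τ) - 1) * gibbs e₂ s := by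
      intro s
      have a1 := gibbs_le_exp_mul h s
      have a2 := gibbs_le_exp_mul h' s
      have p1 := gibbs_pos e₁ s
      have p2 := gibbs_pos e₂ s
      rw [abs_le]
      refine ⟨?_, by linarith⟩
      rcases le_total (gibbs e₁ s) (gibbs e₂ s) with h12 | h12
      · nlinarith [mul_le_mul_of_nonneg_left h12 (by linarith : 0 ≤ Real.exp (2 * τ) - 1)]
      · nlinarith [mul_nonneg (by linarith : 0 ≤ Real.exp (2 * τ) - 1) p2.le]
    calc ∑ s, |gibbs e₁ s - gibbs e₂ s| ≤ ∑ s, (Real.exp (2 * τ) - 1) * gibbs e₂ s :=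
          Finset.sum_le_sum fun s _ => key s
      _ = Real.exp (2 * τ) - 1 := by rw [← Finset.mul_sum, sum_gibbs, mul_one]
      _ ≤ 4 * τ := hexp
  · calc ∑ s, |gibbs e₁ s - gibbs e₂ s| ≤ ∑ s, (gibbs e₁ s + gibbs e₂ s) := by
          refine Finset.sum_le_sum fun s _ => ?_
          rw [abs_le]
          constructor <;> linarith [gibbs_pos e₁ s, gibbs_pos e₂ s]
      _ = 2 := by rw [Finset.sum_add_distrib, sum_gibbs, sum_gibbs]; norm_num
      _ ≤ 4 * τ := by linarith

/-- Expectations are Lipschitz in the exponent, modulo constants. -/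
lemma abs_gibbsMean_sub_le {e₁ e₂ f : X → ℝ} {a τ M : ℝ} (h : ∀ s, |e₁ s - e₂ s - a| ≤ τ)
    (hf : ∀ s, |f s| ≤ M) : |gibbsMean e₁ f - gibbsMean e₂ f| ≤ 4 * M * τ := by
  have hM : 0 ≤ M := (abs_nonneg _).trans (hf (Classical.arbitrary X))
  have : gibbsMean e₁ f - gibbsMean e₂ f = ∑ s, (gibbs e₁ s - gibbs e₂ s) * f s := by
    simp [gibbsMean, sub_mul, Finset.sum_sub_distrib]
  rw [this]
  calc |∑ s, (gibbs e₁ s - gibbs e₂ s) * f s|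
      ≤ ∑ s, |(gibbs e₁ s - gibbs e₂ s) * f s| := Finset.abs_sum_le_sum_abs _ _
    _ ≤ ∑ s, |gibbs e₁ s - gibbs e₂ s| * M := by
        refine Finset.sum_le_sum fun s _ => ?_
        rw [abs_mul]
        exact mul_le_mul_of_nonneg_left (hf s) (abs_nonneg _)
    _ ≤ 4 * τ * M := by
        rw [← Finset.sum_mul]
        exact mul_le_mul_of_nonneg_right (sum_abs_gibbs_sub_le h) hM
    _ = 4 * M * τ := by ring

lemma gibbsKL_nonneg (e₁ e₂ : X → ℝ) : 0 ≤ gibbsKL e₁ e₂ := by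
  have key : ∀ s, gibbs e₁ s - gibbs e₂ s ≤
      gibbs e₁ s * (Real.log (gibbs e₁ s) - Real.log (gibbs e₂ s)) := by
    intro s
    have p1 := gibbs_pos e₁ s
    have p2 := gibbs_pos e₂ s
    have := Real.log_le_sub_one_of_pos (div_pos p2 p1)
    rw [Real.log_div p2.ne' p1.ne'] at this
    have h3 := mul_le_mul_of_nonneg_left this p1.le
    rw [mul_sub, mul_sub, mul_div_cancel₀ _ p1.ne'] at h3
    linarith
  calc (0 : ℝ) = ∑ s, (gibbs e₁ s - gibbs e₂ s) := by
        rw [Finset.sum_sub_distrib, sum_gibbs, sum_gibbs, sub_self]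
    _ ≤ _ := Finset.sum_le_sum fun s _ => key s

/-- In the symmetrized divergence the partition functions cancel, leaving a difference of two means
of `e₁ - e₂ - a`. That function is itself at most `τ` and the distributions are `4τ`-close, which
makes the bound quadratic. The quadratic rate later compensates the factor `1 / r` of the
temperature. -/
lemma gibbsKL_le {e₁ e₂ : X → ℝ} {a τ : ℝ} (h : ∀ s, |e₁ s - e₂ s - a| ≤ τ) :
    gibbsKL e₁ e₂ ≤ 4 * τ ^ 2 := by
  have hsum : gibbsKL e₁ e₂ + gibbsKL e₂ e₁ =
      gibbsMean e₁ (fun s => e₁ s - e₂ s - a) - gibbsMean e₂ (fun s => e₁ s - e₂ s - a) := by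
    simp only [gibbsKL, log_gibbs, gibbsMean_sub, gibbsMean_const]
    ring
  have h1 := abs_gibbsMean_sub_le h h
  have h2 := gibbsKL_nonneg e₂ e₁
  have h3 := le_abs_self (gibbsMean e₁ (fun s => e₁ s - e₂ s - a) -
    gibbsMean e₂ (fun s => e₁ s - e₂ s - a))
  nlinarith

/-- The free energy of a distribution exceeds the minimal one by the relative entropy. -/
lemma free_energy_sub (L e : X → ℝ) {lam : ℝ} (hl : lam ≠ 0) :
    gibbsMean e (fun s => L s + lam * Real.log (gibbs e s)) -
      gibbsMean (fun s => -L s / lam)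
        (fun s => L s + lam * Real.log (gibbs (fun s => -L s / lam) s)) =
      lam * gibbsKL e (fun s => -L s / lam) := by
  have h0 : ∀ s, lam * (-L s / lam) = -L s := fun s => by field_simp
  simp only [gibbsKL, log_gibbs, gibbsMean_add, gibbsMean_const_mul, gibbsMean_sub,
    gibbsMean_const]
  have h2 : ∀ e' : X → ℝ, lam * gibbsMean e' (fun s => -L s / lam) = - gibbsMean e' L := by
    intro e'
    rw [← gibbsMean_const_mul]
    simp only [h0]
    have := gibbsMean_const_mul e' (-1) L
    simpa using this
  have h3 := h2 e
  have h4 := h2 (fun s => -L s / lam)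
  linear_combination h3 - h4

/-- Nonnegativity of the relative entropy to the uniform distribution, which is the Gibbs
distribution of the exponent 0. -/
lemma neg_log_card_le_gibbsMean_log (e : X → ℝ) :
    -Real.log (Fintype.card X) ≤ gibbsMean e fun s => Real.log (gibbs e s) := by
  have h := gibbsKL_nonneg e fun _ => 0
  simp only [gibbsKL, gibbsMean_sub] at h
  have h2 : (fun s : X => Real.log (gibbs (fun _ : X => (0 : ℝ)) s)) =
      fun _ => -Real.log (Fintype.card X) := by
    funext s
    rw [log_gibbs]
    simp
  rw [h2, gibbsMean_const] at h
  linarith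

/-- The mean of `L` at temperature `lam` is within `lam * log |X|` of every value of `L`
from above. -/
lemma gibbsMean_neg_div_le (L : X → ℝ) {lam : ℝ} (hl : 0 < lam) (s₀ : X) :
    gibbsMean (fun s => -L s / lam) L ≤ L s₀ + lam * Real.log (Fintype.card X) := by
  set e : X → ℝ := fun s => -L s / lam with he
  have h1 := neg_log_card_le_gibbsMean_log e
  have h2 : gibbsMean e (fun s => Real.log (gibbs e s)) =
      gibbsMean e e - Real.log (∑ y, Real.exp (e y)) := by
    simp only [log_gibbs, gibbsMean_sub, gibbsMean_const]
  have h3 : lam * gibbsMean e e = -gibbsMean e L := by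
    rw [← gibbsMean_const_mul, ← neg_one_mul, ← gibbsMean_const_mul]
    congr 1
    funext s
    simp only [he]
    field_simp
  have h4 : e s₀ ≤ Real.log (∑ y, Real.exp (e y)) := by
    rw [Real.le_log_iff_exp_le (sum_exp_pos e)]
    exact Finset.single_le_sum (f := fun y => Real.exp (e y))
      (fun y _ => (Real.exp_pos _).le) (Finset.mem_univ s₀)
  have h5 : lam * e s₀ = -L s₀ := by simp only [he]; field_simp
  rw [h2] at h1
  have h6 := mul_le_mul_of_nonneg_left h1 hl.le
  have h7 := mul_le_mul_of_nonneg_left h4 hl.le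
  rw [mul_sub, h3] at h6
  linarith

lemma abs_log_gibbs_le {e : X → ℝ} {E : ℝ} (h : ∀ s, |e s| ≤ E) (s : X) :
    |Real.log (gibbs e s)| ≤ 2 * E + Real.log (Fintype.card X) := by
  have h1 : Real.log (gibbs e s) ≤ 0 := Real.log_nonpos (gibbs_pos e s).le (gibbs_le_one e s)
  have hc : (0 : ℝ) < Fintype.card X := by exact_mod_cast Fintype.card_pos
  have h2 : Real.log (∑ y, Real.exp (e y)) ≤ E + Real.log (Fintype.card X) := by
    rw [Real.log_le_iff_le_exp (sum_exp_pos e), Real.exp_add, Real.exp_log hc]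
    calc ∑ y, Real.exp (e y) ≤ ∑ _y : X, Real.exp E :=
          Finset.sum_le_sum fun y _ => Real.exp_le_exp.2 (abs_le.1 (h y)).2
      _ = _ := by simp [mul_comm]
  rw [abs_of_nonpos h1, log_gibbs]
  linarith [(abs_le.1 (h s)).1]

/-- The expected policy gradient takes this shape: a weight affine in `f` times the centred `f`. The
offset `b` drops out because the second factor has mean zero. -/
lemma gibbsMean_mul_sub_mean (e f : X → ℝ) (a b : ℝ) :
    gibbsMean e (fun s => (a * f s + b) * (f s - gibbsMean e f)) = a * gibbsVar e f := by
  have h0 : gibbsMean e (fun s => f s - gibbsMean e f) = 0 := by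
    rw [gibbsMean_sub, gibbsMean_const, sub_self]
  have h1 : (fun s => (a * f s + b) * (f s - gibbsMean e f)) =
      fun s => a * (f s - gibbsMean e f) ^ 2 +
        (a * gibbsMean e f + b) * (f s - gibbsMean e f) := by
    funext s; ring
  rw [h1, gibbsMean_add, gibbsMean_const_mul, gibbsMean_const_mul, h0, gibbsVar]
  ring

end Gibbs

/-! ### Fourier analysis on the cube -/

section Fourier

variable {n k : ℕ}

lemma card_cube (n : ℕ) : Fintype.card (Cube n) = 2 ^ n := by
  simp [Cube]

lemma intCast_units_mul_self (a : ℤˣ) : ((a : ℤ) : ℝ) * ((a : ℤ) : ℝ) = 1 := by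
  rcases Int.units_eq_one_or a with h | h <;> simp [h]

lemma abs_chi (S : Finset (Fin n)) (x : Cube n) : |chi S x| = 1 := by
  rw [chi, Finset.abs_prod]
  refine Finset.prod_eq_one fun u _ => ?_
  rcases Int.units_eq_one_or (x u) with h | h <;> simp [h]

lemma chi_empty (x : Cube n) : chi ∅ x = 1 := by simp [chi]

/-- The sum factors as `∏ (1 + x_u y_u)`, and a coordinate where `x` and `y` differ contributes a
zero factor. -/
lemma sum_chi_mul_chi (x y : Cube n) :
    ∑ S : Finset (Fin n), chi S x * chi S y = if x = y then 2 ^ n else 0 := by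
  have h1 : ∑ S : Finset (Fin n), chi S x * chi S y =
      ∏ u : Fin n, (1 + ((x u : ℤ) : ℝ) * ((y u : ℤ) : ℝ)) := by
    rw [Finset.prod_one_add, Finset.powerset_univ]
    exact Finset.sum_congr rfl fun S _ => by rw [chi, chi, Finset.prod_mul_distrib]
  rw [h1]
  split_ifs with h
  · subst h
    simp only [intCast_units_mul_self]
    norm_num
  · obtain ⟨u, hu⟩ := Function.ne_iff.1 h
    refine Finset.prod_eq_zero (Finset.mem_univ u) ?_
    rcases Int.units_eq_one_or (x u) with h1 | h1 <;>
      rcases Int.units_eq_one_or (y u) with h2 | h2 <;> simp_all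

/-- Flipping the sign of one coordinate. -/
def flip (u : Fin n) : Cube n ≃ Cube n :=
  Function.Involutive.toPerm (fun x => Function.update x u (-x u)) fun x => by
    funext v
    by_cases h : v = u
    · subst h; simp
    · simp [h]

lemma flip_apply_self (u : Fin n) (x : Cube n) : flip u x u = -x u := by
  simp [flip, Function.Involutive.toPerm]

lemma flip_apply_of_ne {u v : Fin n} (h : v ≠ u) (x : Cube n) : flip u x v = x v := by
  simp [flip, Function.Involutive.toPerm, h]

lemma chi_flip_of_mem {S : Finset (Fin n)} {u : Fin n} (h : u ∈ S) (x : Cube n) :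
    chi S (flip u x) = -chi S x := by
  rw [chi, chi, ← Finset.mul_prod_erase S _ h, ← Finset.mul_prod_erase S _ h, flip_apply_self]
  have : ∏ v ∈ S.erase u, (((flip u x v : ℤˣ) : ℤ) : ℝ) = ∏ v ∈ S.erase u, ((x v : ℤ) : ℝ) :=
    Finset.prod_congr rfl fun v hv => by rw [flip_apply_of_ne (Finset.ne_of_mem_erase hv)]
  rw [this]
  push_cast
  ring

lemma chi_flip_of_notMem {S : Finset (Fin n)} {u : Fin n} (h : u ∉ S) (x : Cube n) :
    chi S (flip u x) = chi S x :=
  Finset.prod_congr rfl fun v hv => by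
    rw [flip_apply_of_ne (ne_of_mem_of_not_mem hv h)]

lemma sum_eq_zero_of_flip {f : Cube n → ℝ} (u : Fin n) (h : ∀ x, f (flip u x) = -f x) :
    ∑ x, f x = 0 := by
  have h1 : ∑ x, f (flip u x) = ∑ x, f x := Equiv.sum_comp (flip u) f
  simp only [h, Finset.sum_neg_distrib] at h1
  linarith

lemma sum_cube_chi_mul_chi (S T : Finset (Fin n)) :
    ∑ x : Cube n, chi S x * chi T x = if S = T then 2 ^ n else 0 := by
  split_ifs with h
  · subst h
    have : ∀ x : Cube n, chi S x * chi S x = 1 := fun x => by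
      rw [← abs_mul_abs_self, abs_chi, one_mul]
    simp [this]
  · have hne : ∃ u, ¬(u ∈ S ↔ u ∈ T) := by
      by_contra! hall
      exact h (Finset.ext hall)
    obtain ⟨u, hu⟩ := hne
    -- Flipping a variable of the symmetric difference of `S` and `T` negates exactly one of the two
    -- monomials.
    refine sum_eq_zero_of_flip u fun x => ?_
    by_cases hS : u ∈ S
    · have hT : u ∉ T := by tauto
      rw [chi_flip_of_mem hS, chi_flip_of_notMem hT]; ring
    · have hT : u ∈ T := by tauto
      rw [chi_flip_of_notMem hS, chi_flip_of_mem hT]; ring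

lemma fourier_expansion (h : Cube n → Bool) (s : Cube n) :
    ∑ S, fourierCoeff h S * chi S s = if h s = true then 1 else 0 := by
  simp only [fourierCoeff, cubeMean, div_mul_eq_mul_div, Finset.sum_mul]
  rw [← Finset.sum_div, Finset.sum_comm]
  simp only [mul_assoc, ← Finset.mul_sum, sum_chi_mul_chi]
  rw [Finset.sum_eq_single s (fun x _ hx => by simp [hx]) (by simp), if_pos rfl]
  split_ifs <;> simp

lemma fourierCoeff_eq_zero {h : Cube n → Bool} {J S : Finset (Fin n)}
    (hJ : DependsOn h (J : Set (Fin n))) (hS : ¬S ⊆ J) : fourierCoeff h S = 0 := by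
  obtain ⟨u, huS, huJ⟩ := Finset.not_subset.1 hS
  rw [fourierCoeff, cubeMean, sum_eq_zero_of_flip u, zero_div]
  intro x
  have : h (flip u x) = h x := hJ fun v hv => by
    rw [flip_apply_of_ne]
    rintro rfl
    exact huJ hv
  rw [this, chi_flip_of_mem huS]
  ring

lemma abs_fourierCoeff_le_one (h : Cube n → Bool) (S : Finset (Fin n)) :
    |fourierCoeff h S| ≤ 1 := by
  rw [fourierCoeff, cubeMean, abs_div, abs_of_pos (by positivity : (0 : ℝ) < 2 ^ n),
    div_le_one (by positivity)]
  calc |∑ x, (if h x = true then 1 else 0) * chi S x|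
      ≤ ∑ x, |(if h x = true then 1 else 0) * chi S x| := Finset.abs_sum_le_sum_abs _ _
    _ ≤ ∑ _x : Cube n, (1 : ℝ) := by
        refine Finset.sum_le_sum fun x _ => ?_
        rw [abs_mul, abs_chi]
        split_ifs <;> simp
    _ = 2 ^ n := by simp

/-- Truncation at degree `k` loses nothing: the coefficients vanish outside the subsets of the at
most `k` relevant variables. -/
lemma sum_idx_fourierCoeff (h : Predicate n k) (s : Cube n) :
    ∑ S : Idx n k, fourierCoeff h.1 S.1 * chi S.1 s = if h.1 s = true then 1 else 0 := by
  rw [← fourier_expansion]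
  obtain ⟨J, hJk, hJ⟩ := h.2
  rw [← Finset.sum_subtype (Finset.univ.filter fun S : Finset (Fin n) => S.card ≤ k)
    (by simp) (fun S => fourierCoeff h.1 S * chi S s)]
  refine Finset.sum_subset (Finset.subset_univ _) fun S _ hS => ?_
  rw [fourierCoeff_eq_zero hJ, zero_mul]
  intro hSJ
  exact hS (by simpa using (Finset.card_le_card hSJ).trans hJk)

lemma energy_eq (P : Instance n k) (w : Param n k) (s : Cube n) :
    energy P w s = ∑ S : Idx n k, instFeature P S * chi S.1 s * w S := by
  simp only [energy, dotProduct, Matrix.mulVec_diagonal, solFeature]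
  exact Finset.sum_congr rfl fun S _ => by ring

lemma cost_eq_sum (P : Instance n k) (s : Cube n) :
    cost P s = ∑ S : Idx n k, instFeature P S * chi S.1 s := by
  simp only [instFeature, neg_mul, Finset.sum_neg_distrib, Finset.sum_mul]
  rw [Finset.sum_comm]
  simp only [sum_idx_fourierCoeff, cost, Finset.sum_boole]

lemma cost_eq_bilinear (P : Instance n k) (s : Cube n) :
    cost P s = instFeature P ⬝ᵥ ((1 : Matrix (Idx n k) (Idx n k) ℝ) *ᵥ solFeature k s) := by
  rw [Matrix.one_mulVec, cost_eq_sum]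
  rfl

lemma cubeMean_dot_solFeature (v : Idx n k → ℝ) :
    cubeMean (fun s : Cube n => v ⬝ᵥ solFeature k s) = v ⟨∅, by simp⟩ := by
  simp only [cubeMean, dotProduct, solFeature]
  rw [Finset.sum_comm]
  have : ∀ S : Idx n k, ∑ x : Cube n, v S * chi S.1 x =
      if S = ⟨∅, by simp⟩ then v S * 2 ^ n else 0 := by
    intro S
    have h := sum_cube_chi_mul_chi S.1 ∅
    simp only [chi_empty, mul_one] at h
    rw [← Finset.mul_sum, h]
    simp only [Subtype.ext_iff, mul_ite, mul_zero]
  simp [this]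

lemma cubeMean_sq (v : Idx n k → ℝ) :
    cubeMean (fun s : Cube n => (v ⬝ᵥ solFeature k s) ^ 2) = ∑ S, v S ^ 2 := by
  rw [cubeMean, div_eq_iff (by positivity)]
  simp only [dotProduct, solFeature, sq (∑ _, _), Finset.sum_mul_sum]
  rw [Finset.sum_comm, Finset.sum_mul]
  refine Finset.sum_congr rfl fun S _ => ?_
  rw [Finset.sum_comm]
  have : ∀ T : Idx n k, ∑ x : Cube n, v S * chi S.1 x * (v T * chi T.1 x) =
      if S = T then v S * v T * 2 ^ n else 0 := by
    intro T
    have h := sum_cube_chi_mul_chi S.1 T.1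
    have h2 : ∀ x : Cube n, v S * chi S.1 x * (v T * chi T.1 x) =
      v S * v T * (chi S.1 x * chi T.1 x) := fun x => by ring
    simp only [h2, ← Finset.mul_sum, h, Subtype.ext_iff, mul_ite, mul_zero]
  simp [this, sq]

lemma cubeVar_dot_solFeature (v : Idx n k → ℝ) :
    cubeVar (fun s : Cube n => v ⬝ᵥ solFeature k s) = ∑ S : Idx n k with S.1 ≠ ∅, v S ^ 2 := by
  set o : Idx n k := ⟨∅, by simp⟩ with ho
  -- The mean is the coefficient of the empty set, so centring amounts to zeroing that coordinate.
  have h1 : ∀ s : Cube n, v ⬝ᵥ solFeature k s - v o = Function.update v o 0 ⬝ᵥ solFeature k s := by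
    intro s
    simp only [dotProduct]
    rw [← Finset.add_sum_erase _ _ (Finset.mem_univ o),
      ← Finset.add_sum_erase (f := fun i => Function.update v o 0 i * _) _ (Finset.mem_univ o)]
    have : solFeature k s o = 1 := by simp [solFeature, ho, chi_empty]
    rw [this]
    simp only [Function.update_self, mul_one, zero_add, add_sub_cancel_left]
    exact Finset.sum_congr rfl fun S hS => by
      rw [Function.update_of_ne (Finset.ne_of_mem_erase hS)]
  rw [cubeVar]
  simp only [cubeMean_dot_solFeature]
  simp only [← ho, h1]
  rw [cubeMean_sq, Finset.sum_filter]
  refine Finset.sum_congr rfl fun S _ => ?_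
  by_cases h : S = o
  · simp [h, ho]
  · have : S.1 ≠ ∅ := fun h' => h (Subtype.ext h')
    simp [h, this]

/-! ### Counting -/

lemma one_le_card_idx (n k : ℕ) : (1 : ℝ) ≤ Fintype.card (Idx n k) := by
  have : 0 < Fintype.card (Idx n k) := Fintype.card_pos_iff.2 ⟨⟨∅, by simp⟩⟩
  exact_mod_cast this

lemma card_idx_le {n : ℕ} (hn : 1 ≤ n) (k : ℕ) : Fintype.card (Idx n k) ≤ (k + 1) * n ^ k := by
  rw [Fintype.card_subtype]
  have : (Finset.univ.filter fun S : Finset (Fin n) => S.card ≤ k) ⊆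
      (Finset.range (k + 1)).biUnion fun i => Finset.powersetCard i Finset.univ := by
    intro S hS
    simp only [Finset.mem_filter, Finset.mem_univ, true_and] at hS
    simp [Finset.mem_powersetCard]
    omega
  refine (Finset.card_le_card this).trans (Finset.card_biUnion_le.trans ?_)
  calc ∑ i ∈ Finset.range (k + 1), (Finset.powersetCard i (Finset.univ : Finset (Fin n))).card
      ≤ ∑ _i ∈ Finset.range (k + 1), n ^ k := by
        refine Finset.sum_le_sum fun i hi => ?_
        rw [Finset.card_powersetCard, Finset.card_univ, Fintype.card_fin]
        exact (Nat.choose_le_pow n i).trans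
          (Nat.pow_le_pow_right hn (by simpa [Nat.lt_succ_iff] using hi))
    _ = (k + 1) * n ^ k := by simp

lemma le_card_idx (n : ℕ) {k : ℕ} (hk : 1 ≤ k) : n ≤ Fintype.card (Idx n k) := by
  have h := Fintype.card_le_of_injective (fun u : Fin n => (⟨{u}, by simpa using hk⟩ : Idx n k))
    fun u v h => by simpa using h
  simpa using h

/-- A predicate is determined by a set of at most `k` relevant variables and a truth table on it, of
which there are at most `2 ^ 2 ^ k`. -/
lemma card_predicate_le (n k : ℕ) :
    Fintype.card (Predicate n k) ≤ Fintype.card (Idx n k) * 2 ^ 2 ^ k := by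
  classical
  choose J hJk hJ using fun h : Predicate n k => h.2
  let ext : (J : Finset (Fin n)) → (J → ℤˣ) → Cube n :=
    fun J a u => if hu : u ∈ J then a ⟨u, hu⟩ else 1
  let f : Predicate n k → Σ S : Idx n k, (S.1 → ℤˣ) → Bool :=
    fun h => ⟨⟨J h, hJk h⟩, fun a => h.1 (ext (J h) a)⟩
  have hext : ∀ (h : Predicate n k) (x : Cube n),
      h.1 x = h.1 (ext (J h) fun u => x u) := by
    intro h x
    refine hJ h fun u hu => ?_
    simp only [ext]
    rw [dif_pos (by simpa using hu)]
  have hf : Function.Injective f := by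
    intro h h' hh
    -- Stated for arbitrary index sets, so that the equality of dependent pairs can be eliminated by
    -- `cases`.
    have key : ∀ (S S' : Idx n k) (g : (S.1 → ℤˣ) → Bool) (g' : (S'.1 → ℤˣ) → Bool),
        (⟨S, g⟩ : Σ S : Idx n k, (S.1 → ℤˣ) → Bool) = ⟨S', g'⟩ →
        ∀ x : Cube n, g (fun u => x u) = g' (fun u => x u) := by
      intro S S' g g' e x
      cases e
      rfl
    apply Subtype.ext
    funext x
    rw [hext h x, hext h' x]
    exact key _ _ _ _ hh x
  refine (Fintype.card_le_of_injective f hf).trans ?_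
  rw [Fintype.card_sigma]
  calc ∑ S : Idx n k, Fintype.card ((S.1 → ℤˣ) → Bool) ≤ ∑ _S : Idx n k, 2 ^ 2 ^ k := by
        refine Finset.sum_le_sum fun S _ => ?_
        simp only [Fintype.card_fun, Fintype.card_bool, Fintype.card_units_int, Fintype.card_coe]
        exact Nat.pow_le_pow_right (by norm_num) (Nat.pow_le_pow_right (by norm_num) S.2)
    _ = _ := by simp

/-! ### Bounds on costs, features and energies -/

lemma abs_cost_le (P : Instance n k) (s : Cube n) :
    |cost P s| ≤ Fintype.card (Predicate n k) := by
  rw [cost, abs_neg, Nat.abs_cast]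
  exact_mod_cast Finset.card_le_univ _

lemma abs_instFeature_le (P : Instance n k) (S : Idx n k) :
    |instFeature P S| ≤ Fintype.card (Predicate n k) := by
  rw [instFeature, abs_neg]
  calc |∑ h ∈ P, fourierCoeff h.1 S.1| ≤ ∑ h ∈ P, |fourierCoeff h.1 S.1| :=
        Finset.abs_sum_le_sum_abs _ _
    _ ≤ ∑ _h ∈ P, (1 : ℝ) := Finset.sum_le_sum fun h _ => abs_fourierCoeff_le_one _ _
    _ = P.card := by simp
    _ ≤ Fintype.card (Predicate n k) := by exact_mod_cast Finset.card_le_univ _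

lemma energy_sub (P : Instance n k) (w v : Param n k) (s : Cube n) :
    energy P (w - v) s = energy P w s - energy P v s := by
  simp [energy_eq, mul_sub, Finset.sum_sub_distrib]

lemma energy_smul (P : Instance n k) (r : ℝ) (w : Param n k) (s : Cube n) :
    energy P (r • w) s = r * energy P w s := by
  simp only [energy_eq, Finset.mul_sum, PiLp.smul_apply, smul_eq_mul]
  exact Finset.sum_congr rfl fun S _ => by ring

lemma abs_energy_le_of_coord {P : Instance n k} {u : Param n k} {τ : ℝ} (h : ∀ S, |u S| ≤ τ)
    (s : Cube n) :
    |energy P u s| ≤ Fintype.card (Idx n k) * (Fintype.card (Predicate n k) * τ) := by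
  rw [energy_eq]
  calc |∑ S : Idx n k, instFeature P S * chi S.1 s * u S|
      ≤ ∑ S : Idx n k, |instFeature P S * chi S.1 s * u S| := Finset.abs_sum_le_sum_abs _ _
    _ ≤ ∑ _S : Idx n k, Fintype.card (Predicate n k) * τ := by
        refine Finset.sum_le_sum fun S _ => ?_
        rw [abs_mul, abs_mul, abs_chi, mul_one]
        exact mul_le_mul (abs_instFeature_le P S) (h S) (abs_nonneg _) (Nat.cast_nonneg _)
    _ = _ := by simp

lemma energy_eq_dot (P : Instance n k) (w : Param n k) (s : Cube n) :
    energy P w s = (fun S => instFeature P S * w S) ⬝ᵥ solFeature k s := by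
  rw [energy_eq]
  exact Finset.sum_congr rfl fun S _ => by rw [solFeature]; ring

/-- Energies deviate from a constant by at most `√(d Var)`. -/
lemma exists_abs_energy_sub_le (P : Instance n k) (u : Param n k) :
    ∃ a, ∀ s, |energy P u s - a| ≤ √(Fintype.card (Idx n k) * cubeVar (energy P u)) := by
  set v : Idx n k → ℝ := fun S => instFeature P S * u S with hv
  have hE : energy P u = fun s => v ⬝ᵥ solFeature k s := funext fun s => energy_eq_dot P u s
  -- The constant is the empty-set coefficient, written as a sum evaluated at the all-ones point.
  -- Cauchy-Schwarz handles the remaining terms.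
  refine ⟨∑ S : Idx n k with ¬S.1 ≠ ∅, v S * solFeature k (fun _ => 1) S, fun s => ?_⟩
  have h1 : energy P u s - ∑ S : Idx n k with ¬S.1 ≠ ∅, v S * solFeature k (fun _ => 1) S =
      ∑ S : Idx n k with S.1 ≠ ∅, v S * chi S.1 s := by
    rw [hE]
    simp only [dotProduct]
    rw [← Finset.sum_filter_add_sum_filter_not Finset.univ
      (fun S : Idx n k => S.1 ≠ ∅)]
    have : ∑ S : Idx n k with ¬S.1 ≠ ∅, v S * solFeature k s S =
        ∑ S : Idx n k with ¬S.1 ≠ ∅, v S * solFeature k (fun _ => 1) S := by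
      refine Finset.sum_congr rfl fun S hS => ?_
      have : S.1 = ∅ := by simpa using hS
      simp [solFeature, this, chi_empty]
    rw [this, add_sub_cancel_right]
    rfl
  rw [h1, hE, cubeVar_dot_solFeature]
  apply Real.abs_le_sqrt
  refine (sq_sum_le_card_mul_sum_sq).trans ?_
  have h2 : ∀ S : Idx n k, (v S * chi S.1 s) ^ 2 = v S ^ 2 := fun S => by
    rw [mul_pow, ← sq_abs (chi S.1 s), abs_chi, one_pow, mul_one]
  simp only [h2]
  refine mul_le_mul_of_nonneg_right ?_ (Finset.sum_nonneg fun S _ => sq_nonneg _)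
  exact_mod_cast Finset.card_le_univ _

lemma cubeVar_le (f : Cube n → ℝ) (a : ℝ) : cubeVar f ≤ cubeMean fun x => (f x - a) ^ 2 := by
  obtain ⟨m, hm⟩ : ∃ m, m = cubeMean f := ⟨_, rfl⟩
  have hs : ∑ x : Cube n, f x = m * 2 ^ n := by
    rw [hm, cubeMean, div_mul_cancel₀ _ (by positivity)]
  have h : ∑ x, (f x - a) ^ 2 = ∑ x, (f x - m) ^ 2 + 2 ^ n * (m - a) ^ 2 := by
    have h1 : ∀ x, (f x - a) ^ 2 = (f x - m) ^ 2 + ((m - a) ^ 2 + 2 * (m - a) * (f x - m)) :=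
      fun x => by ring
    simp only [h1, Finset.sum_add_distrib, ← Finset.mul_sum, Finset.sum_sub_distrib, hs,
      Finset.sum_const, Finset.card_univ, card_cube, nsmul_eq_mul]
    push_cast
    ring
  rw [cubeVar, ← hm, cubeMean, cubeMean, h]
  gcongr
  have : 0 ≤ 2 ^ n * (m - a) ^ 2 := by positivity
  linarith

lemma cubeVar_nonneg (f : Cube n → ℝ) : 0 ≤ cubeVar f :=
  div_nonneg (Finset.sum_nonneg fun _ _ => sq_nonneg _) (by positivity)

/-- At bounded exponents, Gibbs variances dominate the uniform variance. -/
lemma cubeVar_le_gibbsVar {e : Cube n → ℝ} (he : ∀ s, |e s| ≤ 1) (f : Cube n → ℝ) :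
    cubeVar f ≤ 8 * gibbsVar e f := by
  have h1 : ∀ s, 1 / 2 ^ n ≤ 8 * gibbs e s := by
    intro s
    have := gibbs_le_exp_mul (e₁ := fun _ : Cube n => (0 : ℝ)) (e₂ := e) (a := 0) (τ := 1)
      (fun s => by simpa using he s) s
    have h2 : gibbs (fun _ : Cube n => (0 : ℝ)) s = 1 / 2 ^ n := by simp [gibbs]
    rw [h2] at this
    -- The constant 8 comes from `exp 2 ≤ 8`.
    refine this.trans (mul_le_mul_of_nonneg_right ?_ (gibbs_pos e s).le)
    have := Real.exp_one_lt_d9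
    rw [two_mul, Real.exp_add]
    nlinarith [Real.exp_pos 1]
  refine (cubeVar_le f (gibbsMean e f)).trans ?_
  rw [gibbsVar]
  generalize gibbsMean e f = m
  rw [cubeMean, Finset.sum_div, gibbsMean, Finset.mul_sum]
  refine Finset.sum_le_sum fun s _ => ?_
  have := mul_le_mul_of_nonneg_right (h1 s) (sq_nonneg (f s - m))
  calc (f s - m) ^ 2 / 2 ^ n = 1 / 2 ^ n * (f s - m) ^ 2 := by ring
    _ ≤ _ := this
    _ = _ := by ring

end Fourier

/-! ### Gradients -/

section Gradients

variable {n k : ℕ}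

/-- The gradient of the energy with respect to the parameter. -/
def feature (P : Instance n k) (s : Cube n) : Param n k :=
  WithLp.toLp 2 fun S => instFeature P S * chi S.1 s

lemma inner_feature (P : Instance n k) (s : Cube n) (w : Param n k) :
    inner ℝ (feature P s) w = energy P w s := by
  rw [energy_eq, PiLp.inner_apply]
  exact Finset.sum_congr rfl fun S _ => by simp [feature, mul_comm]

lemma phi_eq_gibbs (P : Instance n k) (w : Param n k) : phi P w = gibbs (energy P w) := rfl

/-- The gradient of `log φ` with respect to the parameter. -/
def score (P : Instance n k) (w : Param n k) (s : Cube n) : Param n k :=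
  feature P s - ∑ y, phi P w y • feature P y

lemma inner_score (P : Instance n k) (w u : Param n k) (s : Cube n) :
    inner ℝ (score P w s) u = energy P u s - gibbsMean (energy P w) (energy P u) := by
  rw [score, inner_sub_left, sum_inner, inner_feature, gibbsMean]
  congr 1
  exact Finset.sum_congr rfl fun y _ => by
    rw [real_inner_smul_left, inner_feature, phi_eq_gibbs]

lemma hasFDerivAt_energy_smul (P : Instance n k) (r : ℝ) (s : Cube n) (w : Param n k) :
    HasFDerivAt (fun v => energy P (r • v) s) (r • innerSL ℝ (feature P s)) w := by
  have : (fun v => energy P (r • v) s) = fun v => r • innerSL ℝ (feature P s) v := by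
    funext v
    rw [energy_smul, innerSL_apply_apply, inner_feature, smul_eq_mul]
  rw [this]
  exact (innerSL ℝ (feature P s)).hasFDerivAt.const_smul r

lemma hasGradientAt_log_phi_smul (P : Instance n k) (r : ℝ) (s : Cube n) (w : Param n k) :
    HasGradientAt (fun v => Real.log (phi P (r • v) s)) (r • score P (r • w) s) w := by
  have hf : (fun v => Real.log (phi P (r • v) s)) = fun v =>
      energy P (r • v) s - Real.log (∑ y, Real.exp (energy P (r • v) y)) := by
    funext v
    rw [phi_eq_gibbs, log_gibbs]
  have hZ := sum_exp_pos (energy P (r • w))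
  have h1 := (hasFDerivAt_energy_smul P r s w).sub
    ((HasFDerivAt.fun_sum (u := Finset.univ) fun y _ =>
      (hasFDerivAt_energy_smul P r y w).exp).log hZ.ne')
  rw [hasGradientAt_iff_hasFDerivAt, hf]
  refine h1.congr_fderiv ?_
  ext u
  simp only [_root_.sub_apply, _root_.smul_apply,
    _root_.sum_apply, innerSL_apply_apply, inner_feature, smul_eq_mul,
    InnerProductSpace.toDual_apply_apply, real_inner_smul_left, inner_score, gibbsMean, gibbs]
  rw [mul_sub, Finset.mul_sum, Finset.mul_sum]
  congr 1
  refine Finset.sum_congr rfl fun y _ => ?_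
  field_simp

/-- The regularized loss of one mixture component on one instance. -/
def componentLoss (lam r : ℝ) (P : Instance n k) (w : Param n k) : ℝ :=
  gibbsMean (energy P (r • w)) fun s => cost P s + lam / r * Real.log (phi P (r • w) s)

/-- The policy-gradient estimator for one mixture component on one instance. -/
def componentGrad (lam r : ℝ) (P : Instance n k) (w : Param n k) (s : Cube n) : Param n k :=
  (cost P s + lam / r * Real.log (phi P (r • w) s)) • r • score P (r • w) s

lemma sum_phi_smul_score (P : Instance n k) (w : Param n k) :
    ∑ s, phi P w s • score P w s = 0 := by
  simp only [score, smul_sub, Finset.sum_sub_distrib, ← Finset.sum_smul]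
  rw [phi_eq_gibbs, sum_gibbs, one_smul, sub_self]

/-- Product rule. Differentiating the `log φ` inside the bracket contributes a multiple of the mean
score, which is zero; what remains is the expected policy gradient. -/
lemma hasGradientAt_componentLoss (lam r : ℝ) (P : Instance n k) (w : Param n k) :
    HasGradientAt (componentLoss lam r P)
      (∑ s, phi P (r • w) s • componentGrad lam r P w s) w := by
  have hphi : ∀ s, HasFDerivAt (fun v => phi P (r • v) s)
      (phi P (r • w) s • (InnerProductSpace.toDual ℝ _) (r • score P (r • w) s)) w := by
    intro s
    have h1 := (hasGradientAt_log_phi_smul P r s w).hasFDerivAt.exp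
    have h2 : ∀ v, Real.exp (Real.log (phi P (r • v) s)) = phi P (r • v) s := fun v =>
      Real.exp_log (gibbs_pos _ _)
    simpa only [h2] using h1
  have h := HasFDerivAt.fun_sum (u := Finset.univ) fun s _ =>
    (hphi s).fun_mul (((hasGradientAt_log_phi_smul P r s w).hasFDerivAt.const_mul
      (lam / r)).const_add (cost P s))
  rw [hasGradientAt_iff_hasFDerivAt]
  refine h.congr_fderiv ?_
  have h0 := sum_phi_smul_score P (r • w)
  ext u
  have h0u : ∑ s, phi P (r • w) s * inner ℝ (score P (r • w) s) u = 0 := by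
    have := congrArg (fun x => inner ℝ x u) h0
    simpa [sum_inner, real_inner_smul_left] using this
  simp only [_root_.add_apply, _root_.smul_apply,
    _root_.sum_apply, smul_eq_mul, componentGrad, sum_inner,
    InnerProductSpace.toDual_apply_apply, real_inner_smul_left]
  have h3 : ∑ s, phi P (r • w) s * (lam / r * (r * inner ℝ (score P (r • w) s) u)) = 0 := by
    have : ∀ s, phi P (r • w) s * (lam / r * (r * inner ℝ (score P (r • w) s) u)) =
      lam / r * r * (phi P (r • w) s * inner ℝ (score P (r • w) s) u) := fun s => by ring
    simp only [this, ← Finset.mul_sum, h0u, mul_zero]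
  rw [Finset.sum_add_distrib, h3, zero_add]
  exact Finset.sum_congr rfl fun s _ => by ring

/-- The weight `β / ρ` of the second entropy makes the component with scale `ρ` a free energy at
temperature `lam / ρ`, the temperature at which `ρ • refParam` is the Gibbs parameter. -/
lemma regLoss_eq (lam β ρ : ℝ) (R : PMF (Instance n k)) (w : Param n k) :
    regLoss lam β ρ R w = ∑ P, (R P).toReal *
      ((1 - β) * componentLoss lam 1 P w + β * componentLoss lam ρ P w) := by
  simp only [regLoss, loss, regularizer, negEntropy, priorMean, componentLoss, one_smul, div_one,
    gibbsMean_add, gibbsMean_const_mul, generator, Finset.mul_sum, ← Finset.sum_add_distrib]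
  refine Finset.sum_congr rfl fun P _ => ?_
  simp only [add_mul, Finset.sum_add_distrib, mul_assoc, ← Finset.mul_sum]
  simp only [gibbsMean, ← phi_eq_gibbs]
  ring

lemma loss_eq (β ρ : ℝ) (R : PMF (Instance n k)) (w : Param n k) :
    loss β ρ R w = ∑ P, (R P).toReal *
      ((1 - β) * gibbsMean (energy P w) (cost P) +
        β * gibbsMean (energy P (ρ • w)) (cost P)) := by
  simp only [loss, priorMean, generator]
  refine Finset.sum_congr rfl fun P _ => ?_
  simp only [add_mul, Finset.sum_add_distrib, mul_assoc, ← Finset.mul_sum]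
  rfl

lemma sgdGrad_false (lam ρ : ℝ) (w : Param n k) (P : Instance n k) (s : Cube n) :
    sgdGrad lam ρ w (P, false, s) = componentGrad lam 1 P w s := by
  have h := (hasGradientAt_log_phi_smul P 1 s w).gradient
  simp only [one_smul] at h
  simp [sgdGrad, componentGrad, h]

lemma sgdGrad_true (lam ρ : ℝ) (w : Param n k) (P : Instance n k) (s : Cube n) :
    sgdGrad lam ρ w (P, true, s) = componentGrad lam ρ P w s := by
  simp only [sgdGrad, componentGrad, (hasGradientAt_log_phi_smul P ρ s w).gradient]

lemma sum_sample {V : Type*} [AddCommMonoid V] (f : Sample n k → V) :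
    ∑ ξ, f ξ = ∑ P, (∑ s, f (P, false, s) + ∑ s, f (P, true, s)) := by
  rw [Fintype.sum_prod_type]
  refine Finset.sum_congr rfl fun P _ => ?_
  rw [Fintype.sum_prod_type, Fintype.sum_bool, add_comm]

/-- The expectation of the estimator, by components. -/
lemma sum_sampleProb_smul_sgdGrad (lam β ρ : ℝ) (R : PMF (Instance n k)) (w : Param n k) :
    ∑ ξ, sampleProb β ρ R w ξ • sgdGrad lam ρ w ξ = ∑ P, (R P).toReal •
      ((1 - β) • ∑ s, phi P ((1 : ℝ) • w) s • componentGrad lam 1 P w s +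
        β • ∑ s, phi P (ρ • w) s • componentGrad lam ρ P w s) := by
  rw [sum_sample]
  refine Finset.sum_congr rfl fun P _ => ?_
  simp only [sampleProb, sgdGrad_false, sgdGrad_true, smul_add, Finset.smul_sum, smul_smul,
    one_smul]

theorem hasGradientAt_regLoss (lam β ρ : ℝ) (R : PMF (Instance n k)) (w : Param n k) :
    HasGradientAt (regLoss lam β ρ R) (∑ ξ, sampleProb β ρ R w ξ • sgdGrad lam ρ w ξ) w := by
  rw [sum_sampleProb_smul_sgdGrad, hasGradientAt_iff_hasFDerivAt]
  have h := HasFDerivAt.fun_sum (u := Finset.univ) fun P _ =>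
    (((hasGradientAt_componentLoss lam 1 P w).hasFDerivAt.const_mul (1 - β)).fun_add
      ((hasGradientAt_componentLoss lam ρ P w).hasFDerivAt.const_mul β)).const_mul (R P).toReal
  have hf : regLoss lam β ρ R = fun w => ∑ P, (R P).toReal *
      ((1 - β) * componentLoss lam 1 P w + β * componentLoss lam ρ P w) :=
    funext fun w => regLoss_eq lam β ρ R w
  rw [hf]
  refine h.congr_fderiv ?_
  simp only [map_sum, map_add, map_smul]

/-! ### Comparison with the reference parameter -/

/-- The reference parameter `-1 / lam`, at which `φ` is the Gibbs distribution of the cost at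
temperature `lam`. -/
def refParam (n k : ℕ) (lam : ℝ) : Param n k := WithLp.toLp 2 fun _ => -1 / lam

lemma energy_refParam (P : Instance n k) (lam : ℝ) (s : Cube n) :
    energy P (refParam n k lam) s = -cost P s / lam := by
  rw [energy_eq, cost_eq_sum, ← neg_one_mul, mul_div_right_comm, Finset.mul_sum]
  exact Finset.sum_congr rfl fun S _ => by simp only [refParam]; ring

lemma energy_smul_refParam (P : Instance n k) (lam r : ℝ) :
    energy P (r • refParam n k lam) = fun s => -cost P s / (lam / r) := by
  funext s
  rw [energy_smul, energy_refParam, div_div_eq_mul_div]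
  ring

lemma norm_refParam {lam : ℝ} (hl : 0 < lam) : ‖refParam n k lam‖ = radius n k lam := by
  rw [EuclideanSpace.norm_eq, radius]
  simp only [refParam, Real.norm_eq_abs, sq_abs, Finset.sum_const, Finset.card_univ,
    nsmul_eq_mul]
  rw [Real.sqrt_mul (Nat.cast_nonneg _), Real.sqrt_sq_eq_abs, abs_div, abs_neg, abs_one,
    abs_of_pos hl]
  ring

lemma refParam_mem {lam : ℝ} (hl : 0 < lam) : refParam n k lam ∈ paramSpace n k lam := by
  rw [paramSpace, mem_closedBall_zero_iff, norm_refParam hl]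

lemma componentLoss_sub_refParam {lam r : ℝ} (hl : 0 < lam) (hr : 0 < r) (P : Instance n k)
    (w : Param n k) :
    componentLoss lam r P w - componentLoss lam r P (refParam n k lam) =
      lam / r * gibbsKL (energy P (r • w)) (energy P (r • refParam n k lam)) := by
  simp only [componentLoss, energy_smul_refParam, phi_eq_gibbs]
  exact free_energy_sub (cost P) _ (div_pos hl hr).ne'

lemma gibbsKL_energy_le (P : Instance n k) (r : ℝ) (w v : Param n k) :
    gibbsKL (energy P (r • w)) (energy P (r • v)) ≤
      4 * r ^ 2 * (Fintype.card (Idx n k) * cubeVar (energy P (w - v))) := by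
  obtain ⟨a, ha⟩ := exists_abs_energy_sub_le P (w - v)
  have h : ∀ s, |energy P (r • w) s - energy P (r • v) s - r * a| ≤
      |r| * √(Fintype.card (Idx n k) * cubeVar (energy P (w - v))) := by
    intro s
    rw [energy_smul, energy_smul, ← mul_sub, ← mul_sub, abs_mul, ← energy_sub]
    exact mul_le_mul_of_nonneg_left (ha s) (abs_nonneg _)
  refine (gibbsKL_le h).trans_eq ?_
  rw [mul_pow, sq_abs, Real.sq_sqrt (mul_nonneg (Nat.cast_nonneg _) (cubeVar_nonneg _))]
  ring

lemma gibbsMean_cost_sub_le (P : Instance n k) {r : ℝ} (hr0 : 0 ≤ r) (hr1 : r ≤ 1)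
    (w v : Param n k) :
    gibbsMean (energy P (r • w)) (cost P) - gibbsMean (energy P (r • v)) (cost P) ≤
      4 * Fintype.card (Predicate n k) *
        √(Fintype.card (Idx n k) * cubeVar (energy P (w - v))) := by
  obtain ⟨a, ha⟩ := exists_abs_energy_sub_le P (w - v)
  have h : ∀ s, |energy P (r • w) s - energy P (r • v) s - r * a| ≤
      √(Fintype.card (Idx n k) * cubeVar (energy P (w - v))) := by
    intro s
    rw [energy_smul, energy_smul, ← mul_sub, ← mul_sub, abs_mul, ← energy_sub, abs_of_nonneg hr0]
    exact (mul_le_of_le_one_left (abs_nonneg _) hr1).trans (ha s)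
  exact (le_abs_self _).trans (abs_gibbsMean_sub_le h (abs_cost_le P))

/-- Since `cost = -lam * energy` at the reference parameter, the weight `cost + lam / r * log φ`
equals `lam` times the energy of `w - refParam`, plus a constant. The score paired with `w -
refParam` is the same energy, centred; their product averages to a variance. -/
lemma inner_sum_componentGrad {lam r : ℝ} (hl : lam ≠ 0) (hr : r ≠ 0) (P : Instance n k)
    (w : Param n k) :
    inner ℝ (∑ s, phi P (r • w) s • componentGrad lam r P w s) (w - refParam n k lam) =
      lam * r * gibbsVar (energy P (r • w)) (energy P (w - refParam n k lam)) := by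
  rw [← gibbsMean_mul_sub_mean _ _ (lam * r)
    (-lam * Real.log (∑ y, Real.exp (energy P (r • w) y))), gibbsMean, sum_inner]
  refine Finset.sum_congr rfl fun s _ => ?_
  rw [componentGrad, real_inner_smul_left, real_inner_smul_left, real_inner_smul_left,
    inner_score, phi_eq_gibbs, log_gibbs, energy_sub, energy_refParam, energy_smul]
  field_simp
  ring

end Gradients

/-! ### Projected stochastic gradient descent -/

section SGD

variable {n k : ℕ}

lemma norm_projBall_le {r : ℝ} (hr : 0 ≤ r) (w : Param n k) : ‖projBall r w‖ ≤ r := by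
  rw [projBall]
  split_ifs with h
  · exact h
  · have hw : 0 < ‖w‖ := hr.trans_lt (not_le.1 h)
    rw [norm_smul, Real.norm_of_nonneg (by positivity), div_mul_cancel₀ _ hw.ne']

lemma norm_projBall_sub_le {r : ℝ} (w : Param n k) {v : Param n k} (hv : ‖v‖ ≤ r) :
    ‖projBall r w - v‖ ≤ ‖w - v‖ := by
  rw [projBall]
  split_ifs with h
  · exact le_rfl
  · have hr : 0 ≤ r := (norm_nonneg v).trans hv
    have hrw : r < ‖w‖ := not_le.1 h
    have hw : 0 < ‖w‖ := hr.trans_lt hrw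
    set c := r / ‖w‖ with hc
    have hc1 : c ≤ 1 := (div_le_one hw).2 hrw.le
    have hcw : c * ‖w‖ = r := div_mul_cancel₀ _ hw.ne'
    have hin : inner ℝ w v ≤ ‖w‖ * r :=
      (real_inner_le_norm w v).trans (mul_le_mul_of_nonneg_left hv hw.le)
    -- Expansion around the projected point `c • w`; the cross term is nonnegative because `v` lies
    -- in the ball.
    have h1 : ‖w - v‖ ^ 2 = ‖c • w - v‖ ^ 2 + ‖(1 - c) • w‖ ^ 2 +
        2 * inner ℝ ((1 - c) • w) (c • w - v) := by
      have : w - v = (c • w - v) + (1 - c) • w := by rw [sub_smul, one_smul]; abel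
      rw [this, norm_add_sq_real, real_inner_comm]
      ring
    have h2 : 0 ≤ inner ℝ ((1 - c) • w) (c • w - v) := by
      rw [real_inner_smul_left, inner_sub_right, real_inner_smul_right, real_inner_self_eq_norm_sq]
      refine mul_nonneg (by linarith) ?_
      nlinarith
    refine le_of_sq_le_sq ?_ (norm_nonneg _)
    nlinarith [sq_nonneg ‖(1 - c) • w‖]

lemma sum_toReal {α : Type*} [Fintype α] (R : PMF α) : ∑ a, (R a).toReal = 1 := by
  rw [← ENNReal.toReal_sum fun a _ => R.apply_ne_top a, ← tsum_fintype (L := .unconditional _),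
    R.tsum_coe, ENNReal.toReal_one]

lemma sum_toReal_mul_le {α : Type*} [Fintype α] (R : PMF α) {f : α → ℝ} {a : ℝ}
    (h : ∀ x, f x ≤ a) : ∑ x, (R x).toReal * f x ≤ a := by
  calc ∑ x, (R x).toReal * f x ≤ ∑ x, (R x).toReal * a :=
        Finset.sum_le_sum fun x _ => mul_le_mul_of_nonneg_left (h x) ENNReal.toReal_nonneg
    _ = a := by rw [← Finset.sum_mul, sum_toReal, one_mul]

lemma sampleProb_nonneg {β : ℝ} (h0 : 0 ≤ β) (h1 : β ≤ 1) (ρ : ℝ) (R : PMF (Instance n k))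
    (w : Param n k) (ξ : Sample n k) : 0 ≤ sampleProb β ρ R w ξ := by
  have h2 : 0 ≤ 1 - β := by linarith
  rcases ξ with ⟨P, _ | _, s⟩
  · exact mul_nonneg ENNReal.toReal_nonneg (mul_nonneg h2 (gibbs_pos _ s).le)
  · exact mul_nonneg ENNReal.toReal_nonneg (mul_nonneg h0 (gibbs_pos _ s).le)

lemma sum_sampleProb (β ρ : ℝ) (R : PMF (Instance n k)) (w : Param n k) :
    ∑ ξ, sampleProb β ρ R w ξ = 1 := by
  rw [sum_sample]
  simp only [sampleProb, phi_eq_gibbs, ← Finset.mul_sum, sum_gibbs, mul_one, ← mul_add,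
    sub_add_cancel, sum_toReal]

lemma radius_nonneg {lam : ℝ} (hl : 0 ≤ lam) : 0 ≤ radius n k lam :=
  div_nonneg (Real.sqrt_nonneg _) hl

lemma sgdStep_mem {lam : ℝ} (hl : 0 ≤ lam) (ρ η : ℝ) (w : Param n k) (ξ : Sample n k) :
    sgdStep lam ρ η w ξ ∈ paramSpace n k lam := by
  rw [paramSpace, mem_closedBall_zero_iff]
  exact norm_projBall_le (radius_nonneg hl) _

lemma sgdMean_mono {lam β : ℝ} (hl : 0 ≤ lam) (h0 : 0 ≤ β) (h1 : β ≤ 1) (ρ η : ℝ)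
    (R : PMF (Instance n k)) {f g : Param n k → ℝ} (h : ∀ w ∈ paramSpace n k lam, f w ≤ g w)
    (t : ℕ) : ∀ w ∈ paramSpace n k lam,
      sgdMean lam β ρ η R f t w ≤ sgdMean lam β ρ η R g t w := by
  induction t with
  | zero => exact h
  | succ t ih =>
    intro w _
    exact Finset.sum_le_sum fun ξ _ => mul_le_mul_of_nonneg_left
      (ih _ (sgdStep_mem hl ρ η w ξ)) (sampleProb_nonneg h0 h1 ρ R w ξ)

lemma sgdMean_affine (lam β ρ η : ℝ) (R : PMF (Instance n k)) (f : Param n k → ℝ) (a b : ℝ)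
    (t : ℕ) : ∀ w, sgdMean lam β ρ η R (fun v => b + a * f v) t w =
      b + a * sgdMean lam β ρ η R f t w := by
  induction t with
  | zero => exact fun w => rfl
  | succ t ih =>
    intro w
    simp only [sgdMean, ih, mul_add, Finset.sum_add_distrib, ← Finset.sum_mul, sum_sampleProb,
      one_mul, Finset.mul_sum]
    congr 1
    exact Finset.sum_congr rfl fun ξ _ => by ring

/-- The slope of the regularized loss at `w` in the direction away from the reference
parameter. -/
def drift (lam β ρ : ℝ) (R : PMF (Instance n k)) (w : Param n k) : ℝ :=
  inner ℝ (∑ ξ, sampleProb β ρ R w ξ • sgdGrad lam ρ w ξ) (w - refParam n k lam)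

lemma sum_sampleProb_mul_dist_sq_le {lam β ρ η G : ℝ} (hl : 0 < lam) (h0 : 0 ≤ β) (h1 : β ≤ 1)
    (R : PMF (Instance n k)) (w : Param n k) (hG : ∀ ξ, ‖sgdGrad lam ρ w ξ‖ ^ 2 ≤ G) :
    ∑ ξ, sampleProb β ρ R w ξ * ‖sgdStep lam ρ η w ξ - refParam n k lam‖ ^ 2 ≤
      ‖w - refParam n k lam‖ ^ 2 - 2 * η * drift lam β ρ R w + η ^ 2 * G := by
  set u := w - refParam n k lam with hu
  have key : ∀ ξ, ‖sgdStep lam ρ η w ξ - refParam n k lam‖ ^ 2 ≤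
      ‖u‖ ^ 2 - 2 * η * inner ℝ (sgdGrad lam ρ w ξ) u + η ^ 2 * G := by
    intro ξ
    have h2 : ‖sgdStep lam ρ η w ξ - refParam n k lam‖ ≤
        ‖w - η • sgdGrad lam ρ w ξ - refParam n k lam‖ :=
      norm_projBall_sub_le _ (norm_refParam hl).le
    have h3 : w - η • sgdGrad lam ρ w ξ - refParam n k lam = u - η • sgdGrad lam ρ w ξ := by
      rw [hu]; abel
    rw [h3] at h2
    refine (pow_le_pow_left₀ (norm_nonneg _) h2 2).trans ?_
    rw [norm_sub_sq_real, norm_smul, mul_pow, Real.norm_eq_abs, sq_abs, real_inner_smul_right,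
      real_inner_comm]
    have := mul_le_mul_of_nonneg_left (hG ξ) (sq_nonneg η)
    linarith
  calc ∑ ξ, sampleProb β ρ R w ξ * ‖sgdStep lam ρ η w ξ - refParam n k lam‖ ^ 2
      ≤ ∑ ξ, sampleProb β ρ R w ξ *
          (‖u‖ ^ 2 - 2 * η * inner ℝ (sgdGrad lam ρ w ξ) u + η ^ 2 * G) :=
        Finset.sum_le_sum fun ξ _ =>
          mul_le_mul_of_nonneg_left (key ξ) (sampleProb_nonneg h0 h1 ρ R w ξ)
    _ = _ := by
        have h4 : ∀ ξ, sampleProb β ρ R w ξ *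
            (‖u‖ ^ 2 - 2 * η * inner ℝ (sgdGrad lam ρ w ξ) u + η ^ 2 * G) =
            sampleProb β ρ R w ξ * (‖u‖ ^ 2 + η ^ 2 * G) -
              2 * η * (sampleProb β ρ R w ξ * inner ℝ (sgdGrad lam ρ w ξ) u) := fun ξ => by ring
        simp only [h4, Finset.sum_sub_distrib, ← Finset.sum_mul, ← Finset.mul_sum, sum_sampleProb,
          drift, sum_inner, real_inner_smul_left, ← hu]
        ring

/-- Telescoping of the squared distance to the reference parameter. The induction on `T` keeps the
starting point general, since `sgdMean` conditions on the first sample. -/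
lemma sum_sgdMean_drift_le {lam β ρ η G : ℝ} (hl : 0 < lam) (h0 : 0 ≤ β) (h1 : β ≤ 1)
    (R : PMF (Instance n k))
    (hG : ∀ w ∈ paramSpace n k lam, ∀ ξ, ‖sgdGrad lam ρ w ξ‖ ^ 2 ≤ G) (T : ℕ) :
    ∀ w ∈ paramSpace n k lam,
      2 * η * ∑ t ∈ Finset.range T, sgdMean lam β ρ η R (drift lam β ρ R) t w ≤
        ‖w - refParam n k lam‖ ^ 2 + T * (η ^ 2 * G) := by
  induction T with
  | zero => intro w _; simp
  | succ T ih =>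
    intro w hw
    rw [Finset.sum_range_succ']
    have h2 : 2 * η * ∑ t ∈ Finset.range T, sgdMean lam β ρ η R (drift lam β ρ R) (t + 1) w =
        ∑ ξ, sampleProb β ρ R w ξ * (2 * η * ∑ t ∈ Finset.range T,
          sgdMean lam β ρ η R (drift lam β ρ R) t (sgdStep lam ρ η w ξ)) := by
      simp only [sgdMean, Finset.mul_sum]
      rw [Finset.sum_comm]
      exact Finset.sum_congr rfl fun ξ _ => Finset.sum_congr rfl fun t _ => by ring
    have h3 : ∑ ξ, sampleProb β ρ R w ξ * (2 * η * ∑ t ∈ Finset.range T,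
          sgdMean lam β ρ η R (drift lam β ρ R) t (sgdStep lam ρ η w ξ)) ≤
        ∑ ξ, sampleProb β ρ R w ξ *
          (‖sgdStep lam ρ η w ξ - refParam n k lam‖ ^ 2 + T * (η ^ 2 * G)) :=
      Finset.sum_le_sum fun ξ _ => mul_le_mul_of_nonneg_left
        (ih _ (sgdStep_mem hl.le ρ η w ξ)) (sampleProb_nonneg h0 h1 ρ R w ξ)
    have h4 := sum_sampleProb_mul_dist_sq_le (η := η) hl h0 h1 R w (hG w hw)
    simp only [mul_add, Finset.sum_add_distrib, ← Finset.sum_mul, sum_sampleProb] at h3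
    rw [mul_add, h2]
    have h5 : sgdMean lam β ρ η R (drift lam β ρ R) 0 w = drift lam β ρ R w := rfl
    rw [h5]
    push_cast
    linarith

/-- Averaged guarantee of projected SGD for functions dominated by the drift. -/
lemma sgdAverage_le {lam β ρ η G a b : ℝ} (hl : 0 < lam) (h0 : 0 ≤ β) (h1 : β ≤ 1)
    (hη : 0 < η) (ha : 0 ≤ a) (R : PMF (Instance n k))
    (hG : ∀ w ∈ paramSpace n k lam, ∀ ξ, ‖sgdGrad lam ρ w ξ‖ ^ 2 ≤ G)
    (hd : ∀ w ∈ paramSpace n k lam, 0 ≤ drift lam β ρ R w) {f : Param n k → ℝ}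
    (hf : ∀ w ∈ paramSpace n k lam, f w ≤ b + a * drift lam β ρ R w)
    {T : ℕ} (hT : 1 ≤ T) {w : Param n k} (hw : w ∈ paramSpace n k lam) :
    sgdAverage lam β ρ η R f T w ≤
      b + a * (‖w - refParam n k lam‖ ^ 2 / (2 * η * T) + η * G) := by
  have hT' : (1 : ℝ) ≤ T := by exact_mod_cast hT
  have hG0 : 0 ≤ G := (sq_nonneg _).trans (hG w hw (Classical.arbitrary _))
  have h2 := sum_sgdMean_drift_le (η := η) hl h0 h1 R hG (T + 1) w hw
  have h3 : ∑ t ∈ Finset.Icc 1 T, sgdMean lam β ρ η R f t w ≤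
      ∑ t ∈ Finset.Icc 1 T, (b + a * sgdMean lam β ρ η R (drift lam β ρ R) t w) := by
    refine Finset.sum_le_sum fun t _ => ?_
    rw [← sgdMean_affine]
    exact sgdMean_mono hl.le h0 h1 ρ η R hf t w hw
  -- The time `t = 0` is added at no cost because drifts are nonnegative on the ball. The resulting
  -- `T + 1 ≤ 2T` steps give the noise term `η * G` instead of half of it.
  have h4 : ∑ t ∈ Finset.Icc 1 T, sgdMean lam β ρ η R (drift lam β ρ R) t w ≤
      ∑ t ∈ Finset.range (T + 1), sgdMean lam β ρ η R (drift lam β ρ R) t w := by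
    refine Finset.sum_le_sum_of_subset_of_nonneg (fun t ht => ?_) fun t _ _ => ?_
    · simp only [Finset.mem_Icc] at ht
      simp only [Finset.mem_range]
      omega
    · have := sgdMean_mono hl.le h0 h1 ρ η R (f := fun _ => 0) hd t w hw
      have hz := sgdMean_affine lam β ρ η R (fun _ => 0) 0 0 t w
      simp only [zero_mul, add_zero] at hz
      linarith
  rw [sgdAverage, div_le_iff₀ (by linarith)]
  refine h3.trans ?_
  rw [Finset.sum_add_distrib, ← Finset.mul_sum]
  simp only [Finset.sum_const, Nat.card_Icc, add_tsub_cancel_right, nsmul_eq_mul]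
  have h5 : ∑ t ∈ Finset.range (T + 1), sgdMean lam β ρ η R (drift lam β ρ R) t w ≤
      (‖w - refParam n k lam‖ ^ 2 / (2 * η * T) + η * G) * T := by
    have h6 : (‖w - refParam n k lam‖ ^ 2 / (2 * η * T) + η * G) * T =
        (‖w - refParam n k lam‖ ^ 2 + 2 * T * (η ^ 2 * G)) / (2 * η) := by
      field_simp
    rw [h6, le_div_iff₀ (by linarith)]
    have h7 : ((T + 1 : ℕ) : ℝ) * (η ^ 2 * G) ≤ 2 * T * (η ^ 2 * G) := by
      refine mul_le_mul_of_nonneg_right ?_ (by positivity)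
      push_cast; linarith
    linarith
  have := mul_le_mul_of_nonneg_left (h4.trans h5) ha
  linarith

end SGD

/-! ### Describing the parameters by few bits -/

section Description

/-- The number of vectors of signed magnitudes with bounded sum of magnitudes. -/
lemma card_filter_sum_le {ι : Type*} [Fintype ι] [DecidableEq ι] {δ : ℝ} (hδ : 0 < δ)
    (hδ1 : δ ≤ 1) (B : ℕ) :
    ((Finset.univ.filter fun m : ι → Bool × Fin (B + 1) =>
      δ * ∑ i, ((m i).2 : ℝ) ≤ Fintype.card ι).card : ℝ) ≤ (12 / δ) ^ Fintype.card ι := by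
  set F := Finset.univ.filter fun m : ι → Bool × Fin (B + 1) =>
      δ * ∑ i, ((m i).2 : ℝ) ≤ Fintype.card ι with hF
  -- Generating function bound: each vector is weighted by `x` to the sum of its magnitudes, which
  -- on `F` is at least `exp (-card ι)`. The total weight factors into geometric series, each at
  -- most `2 (1 + δ) / δ ≤ 4 / δ`.
  set x : ℝ := 1 / (1 + δ) with hx
  have hx0 : 0 < x := by positivity
  have h1 : ∀ m ∈ F, (1 : ℝ) ≤ Real.exp 1 ^ Fintype.card ι * ∏ i, x ^ ((m i).2 : ℕ) := by
    intro m hm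
    rw [hF, Finset.mem_filter] at hm
    rw [Finset.prod_pow_eq_pow_sum, hx, one_div, inv_pow, ← div_eq_mul_inv,
      one_le_div (by positivity)]
    calc (1 + δ) ^ (∑ i, ((m i).2 : ℕ)) ≤ Real.exp δ ^ (∑ i, ((m i).2 : ℕ)) :=
          pow_le_pow_left₀ (by positivity) (by linarith [Real.add_one_le_exp δ]) _
      _ = Real.exp (δ * ∑ i, ((m i).2 : ℝ)) := by
          rw [← Real.exp_nat_mul]; push_cast; ring_nf
      _ ≤ Real.exp (Fintype.card ι) := Real.exp_le_exp.2 hm.2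
      _ = _ := by rw [← Real.exp_nat_mul, mul_one]
  have h2 : ∑ c : Bool × Fin (B + 1), x ^ (c.2 : ℕ) ≤ 4 / δ := by
    rw [Fintype.sum_prod_type]
    simp only [Finset.sum_const, Finset.card_univ, Fintype.card_bool, nsmul_eq_mul]
    rw [Fin.sum_univ_eq_sum_range fun j => x ^ j]
    have hg := mul_neg_geom_sum x (B + 1)
    have h3 : (1 - x) = δ / (1 + δ) := by rw [hx]; field_simp; ring
    rw [h3, div_mul_eq_mul_div, div_eq_iff (by positivity)] at hg
    rw [le_div_iff₀ hδ]
    have h4 : 0 < x ^ (B + 1) := by positivity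
    push_cast
    nlinarith
  calc (F.card : ℝ) = ∑ _m ∈ F, (1 : ℝ) := by simp
    _ ≤ ∑ m ∈ F, Real.exp 1 ^ Fintype.card ι * ∏ i, x ^ ((m i).2 : ℕ) := Finset.sum_le_sum h1
    _ ≤ ∑ m : ι → Bool × Fin (B + 1), Real.exp 1 ^ Fintype.card ι * ∏ i, x ^ ((m i).2 : ℕ) :=
        Finset.sum_le_univ_sum_of_nonneg fun m => by positivity
    _ = Real.exp 1 ^ Fintype.card ι *
          (∑ c : Bool × Fin (B + 1), x ^ (c.2 : ℕ)) ^ Fintype.card ι := by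
        have hp : (∑ c : Bool × Fin (B + 1), x ^ (c.2 : ℕ)) ^ Fintype.card ι =
            ∑ m : ι → Bool × Fin (B + 1), ∏ i, x ^ ((m i).2 : ℕ) := by
          rw [← Finset.card_univ (α := ι), ← Finset.prod_const, Finset.prod_univ_sum,
            Fintype.piFinset_univ]
        rw [← Finset.mul_sum, hp]
    _ ≤ 3 ^ Fintype.card ι * (4 / δ) ^ Fintype.card ι := by
        refine mul_le_mul (pow_le_pow_left₀ (Real.exp_pos _).le ?_ _)
          (pow_le_pow_left₀ (Finset.sum_nonneg fun c _ => by positivity) h2 _)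
          (pow_nonneg (Finset.sum_nonneg fun c _ => by positivity) _) (by positivity)
        linarith [Real.exp_one_lt_d9]
    _ = (12 / δ) ^ Fintype.card ι := by rw [← mul_pow]; congr 1; ring

variable {n k : ℕ}

lemma describable_of_finset {A : Set (Param n k)} {a : Param n k} {δ : ℝ} {b : ℕ}
    (D : Finset (Param n k)) (hD : D.card ≤ 2 ^ b) (hA : ∀ x ∈ D, x ∈ A) (ha : a ∈ D)
    (hδ : ∀ w ∈ A, ∃ x ∈ D, ∀ S, |w S - x S| ≤ δ) : Describable A a δ b := by
  have hc : Fintype.card D ≤ Fintype.card (Fin b → Bool) := by simpa using hD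
  obtain ⟨f⟩ := Function.Embedding.nonempty_of_card_le hc
  have : Nonempty D := ⟨⟨a, ha⟩⟩
  have hs : ∀ x ∈ D, ∃ y, ((Function.invFun f y : D) : Param n k) = x := fun x hx =>
    ⟨f ⟨x, hx⟩, by rw [Function.leftInverse_invFun f.injective]⟩
  refine ⟨fun y => (Function.invFun f y : D), fun y => hA _ (Subtype.prop _), hs a ha,
    fun w hw => ?_⟩
  obtain ⟨x, hx, h⟩ := hδ w hw
  obtain ⟨y, hy⟩ := hs x hx
  exact ⟨y, by simpa only [hy] using h⟩

/-- The vector with coordinates `± m γ`. -/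
def gridPoint (γ : ℝ) {B : ℕ} (m : Idx n k → Bool × Fin (B + 1)) : Param n k :=
  WithLp.toLp 2 fun S => (if (m S).1 then 1 else -1) * (((m S).2 : ℕ) * γ)

/-- Cauchy-Schwarz turns the Euclidean radius into an ℓ¹ budget, which after division by the grid
spacing `δ / lam` is `d / δ`. -/
lemma sum_abs_le {w : Param n k} {lam : ℝ} (hw : w ∈ paramSpace n k lam) :
    ∑ S, |w S| ≤ Fintype.card (Idx n k) / lam := by
  rw [paramSpace, mem_closedBall_zero_iff, radius] at hw
  have h1 : (∑ S, |w S|) ^ 2 ≤ Fintype.card (Idx n k) * ‖w‖ ^ 2 := by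
    rw [EuclideanSpace.norm_sq_eq]
    simpa [Finset.card_univ] using
      sq_sum_le_card_mul_sum_sq (s := Finset.univ) (f := fun S : Idx n k => |w S|)
  have h2 := Real.le_sqrt_of_sq_le h1
  rw [Real.sqrt_mul (Nat.cast_nonneg _), Real.sqrt_sq (norm_nonneg _)] at h2
  refine h2.trans ((mul_le_mul_of_nonneg_left hw (Real.sqrt_nonneg _)).trans_eq ?_)
  rw [← mul_div_assoc, Real.mul_self_sqrt (Nat.cast_nonneg _)]

lemma exists_gridPoint {lam δ : ℝ} (hl : 0 < lam) (hδ : 0 < δ) {w : Param n k}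
    (hw : w ∈ paramSpace n k lam) :
    ∃ m : Idx n k → Bool × Fin (⌊Fintype.card (Idx n k) / δ⌋₊ + 1),
      δ * ∑ S, ((m S).2 : ℝ) ≤ Fintype.card (Idx n k) ∧
      gridPoint (δ / lam) m ∈ paramSpace n k lam ∧
      ∀ S, |w S - gridPoint (δ / lam) m S| ≤ δ / lam := by
  set γ := δ / lam with hγ
  have hγ0 : 0 < γ := div_pos hδ hl
  -- Rounding toward zero keeps the grid point inside the ball.
  let j : Idx n k → ℕ := fun S => ⌊|w S| / γ⌋₊
  have hj : ∀ S, (j S : ℝ) ≤ |w S| / γ := fun S => Nat.floor_le (by positivity)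
  have hj2 : ∀ S, |w S| / γ < j S + 1 := fun S => Nat.lt_floor_add_one _
  have hjγ : ∀ S, (j S : ℝ) * γ ≤ |w S| := fun S => (le_div_iff₀ hγ0).1 (hj S)
  have hjγ2 : ∀ S, |w S| < (j S + 1) * γ := fun S => (div_lt_iff₀ hγ0).1 (hj2 S)
  have hsum : ∑ S, (j S : ℝ) ≤ Fintype.card (Idx n k) / δ := by
    calc ∑ S, (j S : ℝ) ≤ ∑ S, |w S| / γ := Finset.sum_le_sum fun S _ => hj S
      _ = (∑ S, |w S|) / γ := by rw [Finset.sum_div]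
      _ ≤ Fintype.card (Idx n k) / lam / γ :=
          div_le_div_of_nonneg_right (sum_abs_le hw) hγ0.le
      _ = _ := by rw [hγ]; field_simp
  have hjB : ∀ S, j S < ⌊Fintype.card (Idx n k) / δ⌋₊ + 1 := fun S => by
    refine Nat.lt_succ_of_le (Nat.le_floor (le_trans ?_ hsum))
    exact Finset.single_le_sum (f := fun S => (j S : ℝ)) (fun _ _ => Nat.cast_nonneg _)
      (Finset.mem_univ S)
  refine ⟨fun S => (decide (0 ≤ w S), ⟨j S, hjB S⟩), ?_, ?_, fun S => ?_⟩
  · rw [mul_comm]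
    exact (le_div_iff₀ hδ).1 hsum
  · rw [paramSpace, mem_closedBall_zero_iff] at hw ⊢
    refine le_trans ?_ hw
    rw [EuclideanSpace.norm_eq, EuclideanSpace.norm_eq]
    refine Real.sqrt_le_sqrt (Finset.sum_le_sum fun S _ => ?_)
    refine pow_le_pow_left₀ (norm_nonneg _) ?_ 2
    rw [gridPoint, Real.norm_eq_abs, Real.norm_eq_abs, abs_mul]
    have : |(if decide (0 ≤ w S) = true then (1 : ℝ) else -1)| = 1 := by split_ifs <;> simp
    rw [this, one_mul, abs_of_nonneg (by positivity)]
    exact hjγ S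
  · have h1 := hjγ S
    have h2 := hjγ2 S
    simp only [gridPoint, decide_eq_true_eq]
    rw [abs_le]
    split_ifs with h
    · rw [abs_of_nonneg h] at h1 h2
      constructor <;> linarith
    · rw [abs_of_neg (not_le.1 h)] at h1 h2
      constructor <;> linarith

theorem exists_describable {lam δ : ℝ} (hl : 0 < lam) (hδ : 0 < δ) (hδ1 : δ ≤ 1)
    {a : Param n k} (ha : a ∈ paramSpace n k lam) :
    ∃ b : ℕ, (b : ℝ) ≤ 6 * Fintype.card (Idx n k) * Real.logb 2 (2 / δ) ∧
      Describable (paramSpace n k lam) a (δ / lam) b := by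
  classical
  set d := Fintype.card (Idx n k) with hd
  have hd1 : (1 : ℝ) ≤ d := one_le_card_idx n k
  have hu : 1 ≤ Real.logb 2 (2 / δ) := by
    rw [Real.le_logb_iff_rpow_le (by norm_num) (by positivity), Real.rpow_one,
      le_div_iff₀ hδ]
    linarith
  -- The factor 5 comes from `24 / δ ≤ (2 / δ) ^ 5`, where 24 leaves room for the extra point `a`.
  -- Rounding up costs one more bit, at most `d * logb 2 (2 / δ)`.
  refine ⟨⌈5 * d * Real.logb 2 (2 / δ)⌉₊, ?_, ?_⟩
  · have := Nat.ceil_lt_add_one (by positivity : 0 ≤ 5 * d * Real.logb 2 (2 / δ))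
    nlinarith
  set b := ⌈5 * d * Real.logb 2 (2 / δ)⌉₊ with hb
  set F := Finset.univ.filter fun m : Idx n k → Bool × Fin (⌊d / δ⌋₊ + 1) =>
      δ * ∑ i, ((m i).2 : ℝ) ≤ d with hF
  refine describable_of_finset
    (insert a ((F.image (gridPoint (δ / lam))).filter (· ∈ paramSpace n k lam)))
    ?_ ?_ (Finset.mem_insert_self _ _) ?_
  · have h1 : ((insert a ((F.image (gridPoint (δ / lam))).filter
        (· ∈ paramSpace n k lam))).card : ℝ) ≤ (12 / δ) ^ d + 1 := by
      have h2 := Finset.card_insert_le a ((F.image (gridPoint (δ / lam))).filter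
        (· ∈ paramSpace n k lam))
      have h3 := (Finset.card_filter_le (F.image (gridPoint (δ / lam)))
        (· ∈ paramSpace n k lam)).trans Finset.card_image_le
      have h4 := card_filter_sum_le (ι := Idx n k) hδ hδ1 ⌊d / δ⌋₊
      have h5 := h2.trans (Nat.add_le_add_right h3 1)
      calc _ ≤ ((F.card + 1 : ℕ) : ℝ) := Nat.cast_le.2 h5
        _ = F.card + 1 := by push_cast; rfl
        _ ≤ _ := by linarith
    have h5 : (12 / δ) ^ d + 1 ≤ (2 : ℝ) ^ b := by
      have hd0 : d ≠ 0 := by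
        rintro h
        rw [h] at hd1
        norm_num at hd1
      have h6 : (1 : ℝ) ≤ (12 / δ) ^ d := one_le_pow₀ (by
        rw [le_div_iff₀ hδ]; linarith)
      have h7 : (2 : ℝ) ≤ 2 ^ d := le_self_pow₀ (by norm_num) hd0
      calc (12 / δ) ^ d + 1 ≤ 2 ^ d * (12 / δ) ^ d := by nlinarith
        _ = (24 / δ) ^ d := by rw [← mul_pow]; congr 1; ring
        _ ≤ ((2 / δ) ^ 5) ^ d := by
            refine pow_le_pow_left₀ (by positivity) ?_ d
            rw [div_pow, div_le_div_iff₀ hδ (by positivity)]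
            have : δ ^ 5 ≤ δ := pow_le_of_le_one hδ.le hδ1 (by norm_num)
            nlinarith
        _ = (2 : ℝ) ^ (5 * d * Real.logb 2 (2 / δ)) := by
            rw [mul_comm (5 * (d : ℝ)), Real.rpow_mul (by norm_num),
              Real.rpow_logb (by norm_num) (by norm_num) (by positivity), ← pow_mul,
              ← Real.rpow_natCast]
            push_cast
            rfl
        _ ≤ (2 : ℝ) ^ (b : ℝ) :=
            Real.rpow_le_rpow_of_exponent_le (by norm_num) (Nat.le_ceil _)
        _ = 2 ^ b := Real.rpow_natCast _ _
    exact_mod_cast h1.trans h5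
  · intro x hx
    rcases Finset.mem_insert.1 hx with rfl | hx
    · exact ha
    · exact (Finset.mem_filter.1 hx).2
  · intro w hw
    obtain ⟨m, hm, hmem, hclose⟩ := exists_gridPoint hl hδ hw
    refine ⟨_, Finset.mem_insert_of_mem (Finset.mem_filter.2
      ⟨Finset.mem_image_of_mem _ (Finset.mem_filter.2 ⟨Finset.mem_univ m, hm⟩), hmem⟩), hclose⟩

end Description

/-! ### Bounds on the parameter space -/

section Bounds

variable {n k : ℕ}

/-- The case `k = 0` is treated apart: `log 2ⁿ ≤ d` may then fail since `d = 1`, but costs are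
constant and scores vanish. -/
lemma chi_idx_zero (S : Idx n 0) (s : Cube n) : chi S.1 s = 1 := by
  have : S.1 = ∅ := Finset.card_eq_zero.1 (Nat.le_zero.1 S.2)
  rw [this, chi_empty]

lemma cost_eq_of_zero (P : Instance n 0) (s s' : Cube n) : cost P s = cost P s' := by
  simp only [cost_eq_sum, chi_idx_zero]

lemma score_eq_zero (P : Instance n 0) (w : Param n 0) (s : Cube n) : score P w s = 0 := by
  have : ∀ y : Cube n, feature P y = feature P s := fun y => by
    simp only [feature, chi_idx_zero]
  simp only [score, this, ← Finset.sum_smul]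
  rw [phi_eq_gibbs, sum_gibbs, one_smul, sub_self]

lemma log_card_cube_le (hk : 1 ≤ k) :
    Real.log (Fintype.card (Cube n)) ≤ Fintype.card (Idx n k) := by
  have h1 : (n : ℝ) ≤ Fintype.card (Idx n k) := by exact_mod_cast le_card_idx n hk
  rw [card_cube]
  push_cast
  rw [Real.log_pow]
  have := Real.log_two_lt_d9
  nlinarith [(Nat.cast_nonneg n : (0 : ℝ) ≤ n)]

lemma norm_feature_le (P : Instance n k) (s : Cube n) :
    ‖feature P s‖ ≤ Fintype.card (Predicate n k) * √(Fintype.card (Idx n k)) := by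
  rw [EuclideanSpace.norm_eq]
  refine Real.sqrt_le_iff.2 ⟨by positivity, ?_⟩
  rw [mul_pow, Real.sq_sqrt (Nat.cast_nonneg _)]
  calc ∑ S, ‖feature P s S‖ ^ 2 ≤ ∑ _S : Idx n k, (Fintype.card (Predicate n k) : ℝ) ^ 2 := by
        refine Finset.sum_le_sum fun S _ => pow_le_pow_left₀ (norm_nonneg _) ?_ 2
        rw [feature, Real.norm_eq_abs, abs_mul, abs_chi, mul_one]
        exact abs_instFeature_le P S
    _ = _ := by simp [mul_comm]

lemma norm_score_le (P : Instance n k) (w : Param n k) (s : Cube n) :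
    ‖score P w s‖ ≤ 2 * (Fintype.card (Predicate n k) * √(Fintype.card (Idx n k))) := by
  have h : ‖∑ y, phi P w y • feature P y‖ ≤
      Fintype.card (Predicate n k) * √(Fintype.card (Idx n k)) := by
    refine (norm_sum_le _ _).trans ?_
    calc ∑ y, ‖phi P w y • feature P y‖ ≤ ∑ y, phi P w y *
          (Fintype.card (Predicate n k) * √(Fintype.card (Idx n k))) := by
          refine Finset.sum_le_sum fun y _ => ?_
          rw [norm_smul, phi_eq_gibbs, Real.norm_of_nonneg (gibbs_pos _ y).le]
          exact mul_le_mul_of_nonneg_left (norm_feature_le P y) (gibbs_pos _ y).le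
      _ = _ := by rw [← Finset.sum_mul, phi_eq_gibbs, sum_gibbs, one_mul]
  refine (norm_sub_le _ _).trans ?_
  linarith [norm_feature_le P s]

lemma abs_energy_le {lam : ℝ} (P : Instance n k) {w : Param n k}
    (hw : w ∈ paramSpace n k lam) (s : Cube n) :
    |energy P w s| ≤ Fintype.card (Predicate n k) * Fintype.card (Idx n k) / lam := by
  rw [paramSpace, mem_closedBall_zero_iff, radius] at hw
  rw [← inner_feature]
  calc |inner ℝ (feature P s) w| ≤ ‖feature P s‖ * ‖w‖ := abs_real_inner_le_norm _ _
    _ ≤ (Fintype.card (Predicate n k) * √(Fintype.card (Idx n k))) *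
          (√(Fintype.card (Idx n k)) / lam) :=
        mul_le_mul (norm_feature_le P s) hw (norm_nonneg _) (by positivity)
    _ = Fintype.card (Predicate n k) *
          (√(Fintype.card (Idx n k)) * √(Fintype.card (Idx n k))) / lam := by ring
    _ = _ := by rw [Real.mul_self_sqrt (Nat.cast_nonneg _)]

lemma abs_energy_smul_le {lam r : ℝ} (hr : 0 ≤ r) (P : Instance n k) {w : Param n k}
    (hw : w ∈ paramSpace n k lam) (s : Cube n) :
    |energy P (r • w) s| ≤
      r * (Fintype.card (Predicate n k) * Fintype.card (Idx n k) / lam) := by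
  rw [energy_smul, abs_mul, abs_of_nonneg hr]
  exact mul_le_mul_of_nonneg_left (abs_energy_le P hw s) hr

lemma norm_componentGrad_le {lam r : ℝ} (hl : 0 < lam) (hl1 : lam ≤ 1) (hr : 0 < r)
    (hr1 : r ≤ 1) (P : Instance n k) {w : Param n k} (hw : w ∈ paramSpace n k lam)
    (s : Cube n) :
    ‖componentGrad lam r P w s‖ ≤
      (Fintype.card (Predicate n k) + 2 * (Fintype.card (Predicate n k) * Fintype.card (Idx n k)) +
        Fintype.card (Idx n k)) *
      (2 * (Fintype.card (Predicate n k) * √(Fintype.card (Idx n k)))) := by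
  rcases Nat.eq_zero_or_pos k with rfl | hk
  · rw [componentGrad, score_eq_zero, smul_zero, smul_zero, norm_zero]
    positivity
  have h1 := abs_log_gibbs_le (abs_energy_smul_le hr.le P hw) s
  have h2 := log_card_cube_le (n := n) hk
  have h3 := abs_cost_le P s
  rw [componentGrad, smul_smul, norm_smul]
  refine mul_le_mul ?_ (norm_score_le P _ s) (norm_nonneg _) (by positivity)
  set M : ℝ := (Fintype.card (Predicate n k) : ℝ)
  set d : ℝ := (Fintype.card (Idx n k) : ℝ)
  have hM : 0 ≤ M := Nat.cast_nonneg _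
  have hd : 0 ≤ d := Nat.cast_nonneg _
  -- The factor `r` of the score cancels the `1 / r` of the temperature, so the bound does not
  -- deteriorate as `ρ` becomes small.
  have h4 : (cost P s + lam / r * Real.log (phi P (r • w) s)) * r =
      cost P s * r + lam * Real.log (phi P (r • w) s) := by field_simp
  rw [h4, Real.norm_eq_abs]
  refine (abs_add_le _ _).trans ?_
  rw [abs_mul, abs_mul, abs_of_pos hr, abs_of_pos hl]
  have h5 : |cost P s| * r ≤ M := (mul_le_of_le_one_right (abs_nonneg _) hr1).trans h3
  have h6 : lam * |Real.log (phi P (r • w) s)| ≤ lam * (2 * (r * (M * d / lam)) + d) :=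
    mul_le_mul_of_nonneg_left (h1.trans (by linarith)) hl.le
  have h7 : lam * (2 * (r * (M * d / lam)) + d) = r * (2 * (M * d)) + lam * d := by
    field_simp
  have h8 : r * (2 * (M * d)) ≤ 2 * (M * d) := mul_le_of_le_one_left (by positivity) hr1
  have h9 : lam * d ≤ d := mul_le_of_le_one_left hd hl1
  linarith

/-- The mean variance, under uniform solutions, of the energy of the deviation from the reference
parameter. -/
def meanVar (lam : ℝ) (R : PMF (Instance n k)) (w : Param n k) : ℝ :=
  ∑ P, (R P).toReal * cubeVar (energy P (w - refParam n k lam))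

lemma meanVar_nonneg (lam : ℝ) (R : PMF (Instance n k)) (w : Param n k) :
    0 ≤ meanVar lam R w :=
  Finset.sum_nonneg fun _ _ => mul_nonneg ENNReal.toReal_nonneg (cubeVar_nonneg _)

lemma drift_eq {lam ρ : ℝ} (hl : lam ≠ 0) (hρ : ρ ≠ 0) (β : ℝ) (R : PMF (Instance n k))
    (w : Param n k) :
    drift lam β ρ R w = ∑ P, (R P).toReal *
      ((1 - β) * (lam * gibbsVar (energy P w) (energy P (w - refParam n k lam))) +
        β * (lam * ρ * gibbsVar (energy P (ρ • w)) (energy P (w - refParam n k lam)))) := by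
  rw [drift, sum_sampleProb_smul_sgdGrad, sum_inner]
  refine Finset.sum_congr rfl fun P _ => ?_
  rw [real_inner_smul_left, inner_add_left, real_inner_smul_left, real_inner_smul_left,
    inner_sum_componentGrad hl hρ, inner_sum_componentGrad hl one_ne_zero, one_smul, mul_one]

/-- The drift is bounded below by the mean variance, thanks to the nearly uniform component. -/
lemma mul_meanVar_le_drift {lam β ρ : ℝ} (hl : 0 < lam) (h0 : 0 ≤ β) (h1 : β ≤ 1) (hρ : 0 < ρ)
    (hE : ρ * (Fintype.card (Predicate n k) * Fintype.card (Idx n k) / lam) ≤ 1)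
    (R : PMF (Instance n k)) {w : Param n k} (hw : w ∈ paramSpace n k lam) :
    β * lam * ρ * meanVar lam R w ≤ 8 * drift lam β ρ R w := by
  rw [drift_eq hl.ne' hρ.ne', meanVar, Finset.mul_sum, Finset.mul_sum]
  refine Finset.sum_le_sum fun P _ => ?_
  have h2 := cubeVar_le_gibbsVar (fun s => (abs_energy_smul_le hρ.le P hw s).trans hE)
    (energy P (w - refParam n k lam))
  have h3 := gibbsVar_nonneg (energy P w) (energy P (w - refParam n k lam))
  have h4 : 0 ≤ (1 - β) * (lam * gibbsVar (energy P w) (energy P (w - refParam n k lam))) :=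
    mul_nonneg (by linarith) (mul_nonneg hl.le h3)
  have h5 := mul_le_mul_of_nonneg_left h2 (by positivity : 0 ≤ β * (lam * ρ))
  have h6 := mul_le_mul_of_nonneg_left
    (by linarith : β * (lam * ρ) * cubeVar (energy P (w - refParam n k lam)) ≤
      8 * ((1 - β) * (lam * gibbsVar (energy P w) (energy P (w - refParam n k lam))) +
        β * (lam * ρ * gibbsVar (energy P (ρ • w)) (energy P (w - refParam n k lam)))))
    (ENNReal.toReal_nonneg (a := R P))
  linarith

lemma regLoss_refParam_le {lam β ρ : ℝ} (hl : 0 < lam) (h0 : 0 ≤ β) (h1 : β ≤ 1) (hρ : 0 < ρ)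
    (R : PMF (Instance n k)) (v : Param n k) :
    regLoss lam β ρ R (refParam n k lam) ≤ regLoss lam β ρ R v := by
  rw [regLoss_eq, regLoss_eq]
  refine Finset.sum_le_sum fun P _ => mul_le_mul_of_nonneg_left ?_ ENNReal.toReal_nonneg
  have h2 : ∀ r : ℝ, 0 < r →
      componentLoss lam r P (refParam n k lam) ≤ componentLoss lam r P v := fun r hr => by
    have := componentLoss_sub_refParam hl hr P v
    have := mul_nonneg (div_pos hl hr).le
      (gibbsKL_nonneg (energy P (r • v)) (energy P (r • refParam n k lam)))
    linarith
  exact add_le_add (mul_le_mul_of_nonneg_left (h2 1 one_pos) (by linarith))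
    (mul_le_mul_of_nonneg_left (h2 ρ hρ) h0)

/-- The relative entropy is of order `r²`, which absorbs the prefactor `lam / r`; both components
obey the same bound. -/
lemma regLoss_le_add_meanVar {lam β ρ : ℝ} (hl : 0 < lam) (h0 : 0 ≤ β) (h1 : β ≤ 1)
    (hρ : 0 < ρ) (hρ1 : ρ ≤ 1) (R : PMF (Instance n k)) (w : Param n k) :
    regLoss lam β ρ R w ≤ regLoss lam β ρ R (refParam n k lam) +
      4 * lam * Fintype.card (Idx n k) * meanVar lam R w := by
  rw [regLoss_eq, regLoss_eq, meanVar, Finset.mul_sum, ← Finset.sum_add_distrib]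
  refine Finset.sum_le_sum fun P _ => ?_
  set V := cubeVar (energy P (w - refParam n k lam)) with hV
  have hdV : 0 ≤ Fintype.card (Idx n k) * V := mul_nonneg (Nat.cast_nonneg _) (cubeVar_nonneg _)
  have h2 : ∀ r : ℝ, 0 < r → r ≤ 1 → componentLoss lam r P w ≤
      componentLoss lam r P (refParam n k lam) + 4 * lam * (Fintype.card (Idx n k) * V) := by
    intro r hr hr1
    have h3 := componentLoss_sub_refParam hl hr P w
    have h4 := mul_le_mul_of_nonneg_left (gibbsKL_energy_le P r w (refParam n k lam))
      (div_pos hl hr).le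
    have h5 : lam / r * (4 * r ^ 2 * (Fintype.card (Idx n k) * V)) =
        r * (4 * lam * (Fintype.card (Idx n k) * V)) := by field_simp
    have h6 : r * (4 * lam * (Fintype.card (Idx n k) * V)) ≤
        4 * lam * (Fintype.card (Idx n k) * V) :=
      mul_le_of_le_one_left (by positivity) hr1
    linarith
  have h3 := mul_le_mul_of_nonneg_left (h2 1 one_pos le_rfl) (by linarith : 0 ≤ 1 - β)
  have h4 := mul_le_mul_of_nonneg_left (h2 ρ hρ hρ1) h0
  have h5 := mul_le_mul_of_nonneg_left (add_le_add h3 h4) (ENNReal.toReal_nonneg (a := R P))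
  linarith

lemma loss_le_add_meanVar {lam β ρ ε : ℝ} (h0 : 0 ≤ β) (h1 : β ≤ 1)
    (hρ : 0 < ρ) (hρ1 : ρ ≤ 1) (hε : 0 < ε) (R : PMF (Instance n k)) (w : Param n k) :
    loss β ρ R w ≤ loss β ρ R (refParam n k lam) + ε / 2 +
      8 * (Fintype.card (Predicate n k) : ℝ) ^ 2 * (Fintype.card (Idx n k) / ε) *
        meanVar lam R w := by
  have hsum : ε / 2 = ∑ P, (R P).toReal * (ε / 2) := by
    rw [← Finset.sum_mul, sum_toReal, one_mul]
  rw [hsum, loss_eq, loss_eq, meanVar, Finset.mul_sum, ← Finset.sum_add_distrib,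
    ← Finset.sum_add_distrib]
  refine Finset.sum_le_sum fun P _ => ?_
  set V := cubeVar (energy P (w - refParam n k lam)) with hV
  set M : ℝ := (Fintype.card (Predicate n k) : ℝ) with hM
  set d : ℝ := (Fintype.card (Idx n k) : ℝ) with hd
  have hdV : 0 ≤ d * V := mul_nonneg (Nat.cast_nonneg _) (cubeVar_nonneg _)
  -- Completing the square trades the square root for a term linear in the variance, at the price of
  -- `ε / 2`.
  have h2 : 4 * M * √(d * V) ≤ ε / 2 + 8 * M ^ 2 * (d / ε) * V := by
    have h3 := Real.sq_sqrt hdV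
    have h4 : ε / 2 + 8 * M ^ 2 * (d / ε) * V - 4 * M * √(d * V) =
        (ε - 4 * M * √(d * V)) ^ 2 / (2 * ε) := by
      field_simp
      linear_combination (-16 * M ^ 2) * h3
    have : 0 ≤ (ε - 4 * M * √(d * V)) ^ 2 / (2 * ε) := by positivity
    linarith
  have h3 := gibbsMean_cost_sub_le P zero_le_one le_rfl w (refParam n k lam)
  have h4 := gibbsMean_cost_sub_le P hρ.le hρ1 w (refParam n k lam)
  rw [one_smul, one_smul] at h3
  have h5 := mul_le_mul_of_nonneg_left (h3.trans h2) (by linarith : 0 ≤ 1 - β)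
  have h6 := mul_le_mul_of_nonneg_left (h4.trans h2) h0
  have h7 := mul_le_mul_of_nonneg_left (add_le_add h5 h6) (ENNReal.toReal_nonneg (a := R P))
  linarith

lemma gibbsMean_refParam_le {lam : ℝ} (hl : 0 < lam) (P : Instance n k) (s₀ : Cube n) :
    gibbsMean (energy P (refParam n k lam)) (cost P) ≤
      cost P s₀ + lam * Fintype.card (Idx n k) := by
  rcases Nat.eq_zero_or_pos k with rfl | hk
  · have : cost P = fun _ => cost P s₀ := funext fun s => cost_eq_of_zero P s s₀
    rw [this, gibbsMean_const]
    have : 0 ≤ lam * Fintype.card (Idx n 0) := by positivity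
    linarith
  · have h := gibbsMean_neg_div_le (cost P) hl s₀
    have he : energy P (refParam n k lam) = fun s => -cost P s / lam :=
      funext fun s => energy_refParam P lam s
    rw [he]
    have := mul_le_mul_of_nonneg_left (log_card_cube_le (n := n) hk) hl.le
    linarith

/-- The first component is a Gibbs distribution at temperature `lam`; the second is charged the
whole range `2M` of the cost, with weight `β`. -/
lemma loss_refParam_le {lam β : ℝ} (hl : 0 < lam) (h0 : 0 ≤ β) (h1 : β ≤ 1) (ρ : ℝ)
    (R : PMF (Instance n k)) :
    loss β ρ R (refParam n k lam) ≤ opt R +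
      (lam * Fintype.card (Idx n k) + 2 * β * Fintype.card (Predicate n k)) := by
  set X : ℝ := lam * Fintype.card (Idx n k) + 2 * β * Fintype.card (Predicate n k) with hX
  have hsum : X = ∑ P, (R P).toReal * X := by rw [← Finset.sum_mul, sum_toReal, one_mul]
  rw [hsum, loss_eq, opt, priorMean, ← Finset.sum_add_distrib]
  refine Finset.sum_le_sum fun P _ => ?_
  rw [← mul_add]
  refine mul_le_mul_of_nonneg_left ?_ ENNReal.toReal_nonneg
  obtain ⟨s₀, hs₀⟩ := exists_eq_ciInf_of_finite (f := cost P)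
  rw [← hs₀]
  have h2 := gibbsMean_refParam_le hl P s₀
  have h3 : gibbsMean (energy P (ρ • refParam n k lam)) (cost P) ≤
      cost P s₀ + 2 * Fintype.card (Predicate n k) := by
    have h4 := gibbsMean_mono (energy P (ρ • refParam n k lam))
      (fun s => (abs_le.1 (abs_cost_le P s)).2)
    rw [gibbsMean_const] at h4
    have h5 : gibbsMean (energy P (ρ • refParam n k lam)) (cost P) ≤
      Fintype.card (Predicate n k) := h4
    linarith [(abs_le.1 (abs_cost_le P s₀)).1]
  have h4 := mul_le_mul_of_nonneg_left h2 (by linarith : 0 ≤ 1 - β)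
  have h5 := mul_le_mul_of_nonneg_left h3 h0
  have h6 : 0 ≤ β * (lam * Fintype.card (Idx n k)) := by positivity
  rw [hX]
  linarith

lemma abs_loss_sub_le {β ρ τ : ℝ} (h0 : 0 ≤ β) (h1 : β ≤ 1) (hρ : 0 ≤ ρ)
    (hρ1 : ρ ≤ 1) (R : PMF (Instance n k)) {w v : Param n k} (h : ∀ S, |w S - v S| ≤ τ) :
    |loss β ρ R w - loss β ρ R v| ≤
      4 * Fintype.card (Predicate n k) *
        (Fintype.card (Idx n k) * (Fintype.card (Predicate n k) * τ)) := by
  set X : ℝ := 4 * Fintype.card (Predicate n k) *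
        (Fintype.card (Idx n k) * (Fintype.card (Predicate n k) * τ)) with hX
  have key : ∀ (P : Instance n k) (r : ℝ), 0 ≤ r → r ≤ 1 →
      |gibbsMean (energy P (r • w)) (cost P) - gibbsMean (energy P (r • v)) (cost P)| ≤ X := by
    intro P r hr hr1
    refine abs_gibbsMean_sub_le (a := 0) (fun s => ?_) (abs_cost_le P)
    rw [sub_zero, energy_smul, energy_smul, ← mul_sub, ← energy_sub, abs_mul, abs_of_nonneg hr]
    exact (mul_le_of_le_one_left (abs_nonneg _) hr1).trans
      (abs_energy_le_of_coord (u := w - v) h s)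
  rw [loss_eq, loss_eq, ← Finset.sum_sub_distrib]
  refine (Finset.abs_sum_le_sum_abs _ _).trans ?_
  simp only [← mul_sub, abs_mul, abs_of_nonneg ENNReal.toReal_nonneg]
  refine sum_toReal_mul_le R fun P => ?_
  have h2 := key P 1 zero_le_one le_rfl
  have h3 := key P ρ hρ hρ1
  rw [one_smul, one_smul] at h2
  rw [abs_le] at h2 h3 ⊢
  have a1 := mul_le_mul_of_nonneg_left h2.1 (by linarith : 0 ≤ 1 - β)
  have a2 := mul_le_mul_of_nonneg_left h2.2 (by linarith : 0 ≤ 1 - β)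
  have b1 := mul_le_mul_of_nonneg_left h3.1 h0
  have b2 := mul_le_mul_of_nonneg_left h3.2 h0
  constructor <;> linarith

end Bounds

/-! ### Choice of the scalars -/

section Assembly

variable {n k : ℕ}

lemma norm_sgdGrad_sq_le {K ρ : ℝ} (hK : 8 ≤ K)
    (hd : (Fintype.card (Idx n k) : ℝ) ≤ K / 4)
    (hM : (Fintype.card (Predicate n k) : ℝ) ≤ K / 4) (hρ : 0 < ρ) (hρ1 : ρ ≤ 1) {w : Param n k}
    (hw : w ∈ paramSpace n k (1 / K)) (ξ : Sample n k) : ‖sgdGrad (1 / K) ρ w ξ‖ ^ 2 ≤ K ^ 8 := by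
  have hK0 : 0 < K := by linarith
  have hl : 0 < 1 / K := by positivity
  have hl1 : 1 / K ≤ 1 := by rw [div_le_one hK0]; linarith
  have hd1 := one_le_card_idx n k
  have key : ∀ r : ℝ, 0 < r → r ≤ 1 → ∀ P s, ‖componentGrad (1 / K) r P w s‖ ≤ K ^ 4 := by
    intro r hr hr1 P s
    refine (norm_componentGrad_le hl hl1 hr hr1 P hw s).trans ?_
    set M : ℝ := (Fintype.card (Predicate n k) : ℝ)
    set d : ℝ := (Fintype.card (Idx n k) : ℝ)
    have hM0 : 0 ≤ M := Nat.cast_nonneg _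
    have hMd : M * d ≤ K / 4 * (K / 4) := mul_le_mul hM hd (by linarith) (by linarith)
    have hs : √d ≤ d := by
      rw [Real.sqrt_le_left (by linarith)]
      nlinarith
    have hMs : M * √d ≤ K / 4 * (K / 4) :=
      (mul_le_mul_of_nonneg_left hs hM0).trans hMd
    calc _ ≤ K ^ 2 * K ^ 2 := by
          refine mul_le_mul ?_ ?_ (by positivity) (by positivity) <;> nlinarith
      _ = K ^ 4 := by ring
  have h2 : ‖sgdGrad (1 / K) ρ w ξ‖ ≤ K ^ 4 := by
    rcases ξ with ⟨P, _ | _, s⟩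
    · rw [sgdGrad_false]
      exact key 1 one_pos le_rfl P s
    · rw [sgdGrad_true]
      exact key ρ hρ hρ1 P s
  calc _ ≤ (K ^ 4) ^ 2 := pow_le_pow_left₀ (norm_nonneg _) h2 2
    _ = K ^ 8 := by ring

lemma norm_sub_refParam_sq_le {K : ℝ} (hK : 8 ≤ K)
    (hd : (Fintype.card (Idx n k) : ℝ) ≤ K / 4) {w : Param n k}
    (hw : w ∈ paramSpace n k (1 / K)) : ‖w - refParam n k (1 / K)‖ ^ 2 ≤ K ^ 3 := by
  have hl : 0 < 1 / K := by positivity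
  rw [paramSpace, mem_closedBall_zero_iff] at hw
  have h1 : ‖w - refParam n k (1 / K)‖ ≤ 2 * radius n k (1 / K) := by
    refine (norm_sub_le _ _).trans ?_
    rw [norm_refParam hl]
    linarith
  calc _ ≤ (2 * radius n k (1 / K)) ^ 2 := pow_le_pow_left₀ (norm_nonneg _) h1 2
    _ = 4 * Fintype.card (Idx n k) * K ^ 2 := by
        rw [radius, mul_pow, div_pow, Real.sq_sqrt (Nat.cast_nonneg _)]
        field_simp
        ring
    _ ≤ K * K ^ 2 := mul_le_mul_of_nonneg_right (by linarith) (by positivity)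
    _ = K ^ 3 := by ring

variable {K ε : ℝ}

/-- With `ρ = K⁻³` the exponents of the second component stay below 1, since `M * d * K ≤ K ^ 3`;
and `β * lam * ρ = K⁻⁵`. -/
lemma meanVar_le_drift (hK : 8 ≤ K) (hd : (Fintype.card (Idx n k) : ℝ) ≤ K / 4)
    (hM : (Fintype.card (Predicate n k) : ℝ) ≤ K / 4) (R : PMF (Instance n k)) {w : Param n k}
    (hw : w ∈ paramSpace n k (1 / K)) :
    meanVar (1 / K) R w ≤ 8 * K ^ 5 * drift (1 / K) (1 / K) ((1 / K) ^ 3) R w := by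
  have hK0 : 0 < K := by linarith
  have hl1 : 1 / K ≤ 1 := by rw [div_le_one hK0]; linarith
  have hE : (1 / K) ^ 3 *
      (Fintype.card (Predicate n k) * Fintype.card (Idx n k) / (1 / K)) ≤ 1 := by
    have hMd : (Fintype.card (Predicate n k) : ℝ) * Fintype.card (Idx n k) ≤ K / 4 * (K / 4) :=
      mul_le_mul hM hd (Nat.cast_nonneg _) (by linarith)
    have : (1 / K) ^ 3 *
      (Fintype.card (Predicate n k) * Fintype.card (Idx n k) / (1 / K)) =
      Fintype.card (Predicate n k) * Fintype.card (Idx n k) / K ^ 2 := by field_simp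
    rw [this, div_le_one (by positivity)]
    nlinarith
  have h := mul_meanVar_le_drift (by positivity : 0 < 1 / K) (by positivity) hl1
    (by positivity : 0 < (1 / K) ^ 3) hE R hw
  have h2 := mul_le_mul_of_nonneg_left h (by positivity : 0 ≤ K ^ 5)
  have h3 : K ^ 5 * (1 / K * (1 / K) * (1 / K) ^ 3 * meanVar (1 / K) R w) =
      meanVar (1 / K) R w := by field_simp
  linarith

/-- Projected SGD with step size `K⁻¹⁷` is accurate after `K²⁹` steps, where `K` is the inverse
regularization strength. -/
theorem sgd_guarantee (hε : 0 < ε) (hK : 8 ≤ K) (hd : (Fintype.card (Idx n k) : ℝ) ≤ K / 4)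
    (hM : (Fintype.card (Predicate n k) : ℝ) ≤ K / 4)
    (hdε : (Fintype.card (Idx n k) : ℝ) ≤ K * ε / 4) (R : PMF (Instance n k)) {w : Param n k}
    (hw : w ∈ paramSpace n k (1 / K)) {T : ℕ} (hT : K ^ 29 ≤ (T : ℝ)) :
    sgdAverage (1 / K) (1 / K) ((1 / K) ^ 3) ((1 / K) ^ 17) R
        (loss (1 / K) ((1 / K) ^ 3) R) T w ≤
      loss (1 / K) ((1 / K) ^ 3) R (refParam n k (1 / K)) + ε ∧
    sgdAverage (1 / K) (1 / K) ((1 / K) ^ 3) ((1 / K) ^ 17) R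
        (regLoss (1 / K) (1 / K) ((1 / K) ^ 3) R) T w ≤
      regLoss (1 / K) (1 / K) ((1 / K) ^ 3) R (refParam n k (1 / K)) + ε := by
  have hK0 : 0 < K := by linarith
  have hl : 0 < 1 / K := by positivity
  have hl1 : 1 / K ≤ 1 := by rw [div_le_one hK0]; linarith
  have hρ : 0 < (1 / K) ^ 3 := by positivity
  have hρ1 : (1 / K) ^ 3 ≤ 1 := pow_le_one₀ hl.le hl1
  have hd1 := one_le_card_idx n k
  have hK29 : 1 ≤ K ^ 29 := one_le_pow₀ (by linarith)
  have hT0 : 0 < (T : ℝ) := by linarith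
  have hT1 : 1 ≤ T := by exact_mod_cast hT0
  have hG := fun w (hw : w ∈ paramSpace n k (1 / K)) ξ =>
    norm_sgdGrad_sq_le hK hd hM hρ hρ1 hw ξ
  have hdrift : ∀ w ∈ paramSpace n k (1 / K),
      0 ≤ drift (1 / K) (1 / K) ((1 / K) ^ 3) R w := fun w hw => by
    have h1 := (meanVar_nonneg (1 / K) R w).trans (meanVar_le_drift hK hd hM R hw)
    exact nonneg_of_mul_nonneg_right h1 (by positivity)
  have hK2 : 64 ≤ K ^ 2 := by nlinarith
  have h1K : 1 / K ≤ ε / 4 := by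
    rw [div_le_iff₀ hK0]
    linarith
  -- With squared distance at most `K³` and squared gradients at most `K⁸`, the two terms are at
  -- most `1 / (2K)` and `1 / K`; moreover `1 / K ≤ ε / 4` because `1 ≤ d ≤ K * ε / 4`.
  have herr : K ^ 8 * (‖w - refParam n k (1 / K)‖ ^ 2 / (2 * (1 / K) ^ 17 * T) +
      (1 / K) ^ 17 * K ^ 8) ≤ ε / 2 := by
    have h2 := norm_sub_refParam_sq_le hK hd hw
    have h3 : ‖w - refParam n k (1 / K)‖ ^ 2 / (2 * (1 / K) ^ 17 * T) ≤
        K ^ 3 / (2 * (1 / K) ^ 17 * K ^ 29) := by gcongr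
    have h4 : K ^ 8 * (K ^ 3 / (2 * (1 / K) ^ 17 * K ^ 29) + (1 / K) ^ 17 * K ^ 8) =
        (1 / K) * (3 / 2) := by field_simp; norm_num
    have h5 := mul_le_mul_of_nonneg_left
      (add_le_add_left h3 ((1 / K) ^ 17 * K ^ 8)) (by positivity : 0 ≤ K ^ 8)
    linarith
  constructor
  · have hf : ∀ w ∈ paramSpace n k (1 / K), loss (1 / K) ((1 / K) ^ 3) R w ≤
        (loss (1 / K) ((1 / K) ^ 3) R (refParam n k (1 / K)) + ε / 2) +
          K ^ 8 * drift (1 / K) (1 / K) ((1 / K) ^ 3) R w := by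
      intro w hw
      have h2 := loss_le_add_meanVar (lam := 1 / K) hl.le hl1 hρ hρ1 hε R w
      have h3 := meanVar_le_drift hK hd hM R hw
      have h4 : 8 * (Fintype.card (Predicate n k) : ℝ) ^ 2 * (Fintype.card (Idx n k) / ε) ≤
          K ^ 3 / 8 := by
        have a1 : (Fintype.card (Idx n k) : ℝ) / ε ≤ K / 4 := by
          rw [div_le_iff₀ hε]; linarith
        have a2 : (Fintype.card (Predicate n k) : ℝ) ^ 2 ≤ (K / 4) ^ 2 :=
          pow_le_pow_left₀ (Nat.cast_nonneg _) hM 2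
        calc _ ≤ 8 * (K / 4) ^ 2 * (K / 4) := by gcongr
          _ = K ^ 3 / 8 := by ring
      have h5 := mul_le_mul h4 h3 (meanVar_nonneg _ _ _) (by positivity)
      have h6 : K ^ 3 / 8 * (8 * K ^ 5 * drift (1 / K) (1 / K) ((1 / K) ^ 3) R w) =
          K ^ 8 * drift (1 / K) (1 / K) ((1 / K) ^ 3) R w := by ring
      linarith
    have h := sgdAverage_le hl hl.le hl1 (by positivity : 0 < (1 / K) ^ 17)
      (by positivity : 0 ≤ K ^ 8) R hG hdrift hf hT1 hw
    linarith
  · have hf : ∀ w ∈ paramSpace n k (1 / K), regLoss (1 / K) (1 / K) ((1 / K) ^ 3) R w ≤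
        regLoss (1 / K) (1 / K) ((1 / K) ^ 3) R (refParam n k (1 / K)) +
          K ^ 8 * drift (1 / K) (1 / K) ((1 / K) ^ 3) R w := by
      intro w hw
      have h2 := regLoss_le_add_meanVar hl hl.le hl1 hρ hρ1 R w
      have h3 := meanVar_le_drift hK hd hM R hw
      have h4 : 4 * (1 / K) * (Fintype.card (Idx n k) : ℝ) ≤ 1 := by
        rw [mul_one_div, div_mul_eq_mul_div, div_le_one hK0]
        linarith
      have h5 := mul_le_mul h4 h3 (meanVar_nonneg _ _ _) zero_le_one
      have h6 : 8 * K ^ 5 * drift (1 / K) (1 / K) ((1 / K) ^ 3) R w ≤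
          K ^ 8 * drift (1 / K) (1 / K) ((1 / K) ^ 3) R w := by
        refine mul_le_mul_of_nonneg_right ?_ (hdrift w hw)
        have : K ^ 8 = K ^ 5 * (K * K ^ 2) := by ring
        rw [this, mul_comm]
        refine mul_le_mul_of_nonneg_left ?_ (by positivity)
        nlinarith
      linarith
    have h := sgdAverage_le hl hl.le hl1 (by positivity : 0 < (1 / K) ^ 17)
      (by positivity : 0 ≤ K ^ 8) R hG hdrift hf hT1 hw
    linarith

lemma loss_refParam_le_add (hε : 0 < ε) (hK : 8 ≤ K)
    (hdε : (Fintype.card (Idx n k) : ℝ) ≤ K * ε / 4)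
    (hMε : (Fintype.card (Predicate n k) : ℝ) ≤ K * ε / 4) (ρ : ℝ) (R : PMF (Instance n k)) :
    loss (1 / K) ρ R (refParam n k (1 / K)) ≤ opt R + ε := by
  have hK0 : 0 < K := by linarith
  have hl1 : 1 / K ≤ 1 := by rw [div_le_one hK0]; linarith
  have h := loss_refParam_le (by positivity : 0 < 1 / K) (by positivity) hl1 ρ R
  have h2 : 1 / K * (Fintype.card (Idx n k) : ℝ) ≤ ε / 4 := by
    rw [one_div_mul_eq_div, div_le_iff₀ hK0]
    linarith
  have h3 : 1 / K * (Fintype.card (Predicate n k) : ℝ) ≤ ε / 4 := by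
    rw [one_div_mul_eq_div, div_le_iff₀ hK0]
    linarith
  linarith

lemma abs_loss_sub_le_pow {ρ δ : ℝ} (hK : 8 ≤ K)
    (hd : (Fintype.card (Idx n k) : ℝ) ≤ K / 4)
    (hM : (Fintype.card (Predicate n k) : ℝ) ≤ K / 4) (hρ : 0 ≤ ρ) (hρ1 : ρ ≤ 1) (hδ : 0 ≤ δ)
    (R : PMF (Instance n k)) {w v : Param n k} (h : ∀ S, |w S - v S| ≤ δ / (1 / K)) :
    |loss (1 / K) ρ R w - loss (1 / K) ρ R v| ≤ K ^ 4 * δ := by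
  have hK0 : 0 < K := by linarith
  have hl1 : 1 / K ≤ 1 := by rw [div_le_one hK0]; linarith
  refine (abs_loss_sub_le (by positivity) hl1 hρ hρ1 R h).trans ?_
  calc _ ≤ 4 * (K / 4) * ((K / 4) * ((K / 4) * (δ / (1 / K)))) := by gcongr
    _ = K ^ 4 * δ / 16 := by field_simp; ring
    _ ≤ K ^ 4 * δ := div_le_self (by positivity) (by norm_num)

/-- Provides `K = 2 ^ q`, within a factor 2 of `4 * A * N`, so that all scalars are powers of `1 /
2`. -/
lemma exists_two_pow {A N : ℝ} (hA : 1 ≤ A) (hN : 2 ≤ N) :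
    ∃ q : ℕ, 4 * A * N ≤ 2 ^ q ∧ (2 : ℝ) ^ q ≤ 8 * A * N ∧
      (q : ℝ) ≤ (1 + 16 * A) * Real.logb 2 N := by
  have h0 : 0 < 4 * A * N := by positivity
  have h1 : 1 ≤ Real.logb 2 N := by
    rw [Real.le_logb_iff_rpow_le (by norm_num) (by linarith), Real.rpow_one]
    exact hN
  have hx : 0 ≤ Real.logb 2 (4 * A * N) := Real.logb_nonneg (by norm_num) (by nlinarith)
  have hlt := Nat.ceil_lt_add_one hx
  have he : (2 : ℝ) ^ Real.logb 2 (4 * A * N) = 4 * A * N :=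
    Real.rpow_logb (by norm_num) (by norm_num) h0
  refine ⟨⌈Real.logb 2 (4 * A * N)⌉₊, ?_, ?_, ?_⟩
  · rw [← Real.rpow_natCast]
    exact he.symm.le.trans (Real.rpow_le_rpow_of_exponent_le (by norm_num) (Nat.le_ceil _))
  · rw [← Real.rpow_natCast]
    refine (Real.rpow_le_rpow_of_exponent_le (by norm_num) hlt.le).trans ?_
    rw [Real.rpow_add (by norm_num), he, Real.rpow_one]
    linarith
  · have h2 : Real.logb 2 (4 * A * N) + 1 = Real.logb 2 (8 * A) + Real.logb 2 N := by
      rw [← Real.logb_mul (by positivity) (by positivity)]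
      have : Real.logb 2 2 = 1 := Real.logb_self_eq_one (by norm_num)
      rw [← this, ← Real.logb_mul (by positivity) (by norm_num)]
      congr 1
      ring
    have h3 : Real.logb 2 (8 * A) ≤ 16 * A := by
      rw [Real.logb, div_le_iff₀ (Real.log_pos (by norm_num))]
      have := Real.log_le_sub_one_of_pos (by positivity : 0 < 8 * A)
      have := Real.log_two_gt_d9
      nlinarith
    nlinarith

lemma card_predicate_le_mul_pow {n : ℕ} (hn : 1 ≤ n) (k : ℕ) :
    (Fintype.card (Predicate n k) : ℝ) ≤ (k + 1) * 2 ^ 2 ^ k * (n : ℝ) ^ k := by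
  have h := (card_predicate_le n k).trans (Nat.mul_le_mul_right _ (card_idx_le hn k))
  calc (Fintype.card (Predicate n k) : ℝ) ≤ (((k + 1) * n ^ k * 2 ^ 2 ^ k : ℕ) : ℝ) :=
        Nat.cast_le.2 h
    _ = _ := by push_cast; ring

lemma card_idx_le_mul_pow {n : ℕ} (hn : 1 ≤ n) (k : ℕ) :
    (Fintype.card (Idx n k) : ℝ) ≤ (k + 1) * 2 ^ 2 ^ k * (n : ℝ) ^ k := by
  calc (Fintype.card (Idx n k) : ℝ) ≤ (((k + 1) * n ^ k : ℕ) : ℝ) :=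
        Nat.cast_le.2 (card_idx_le hn k)
    _ = (k + 1) * 1 * (n : ℝ) ^ k := by push_cast; ring
    _ ≤ _ := by
        gcongr
        exact one_le_pow₀ (by norm_num)

end Assembly

end

end MaxKCSP

/-! ### The main theorem -/

open MaxKCSP in
open scoped Matrix in
theorem mainTheorem6 :
    -- the cost is bilinear in the features, with the identity matrix
    (∀ (n k : ℕ) (P : Instance n k) (s : Cube n),
      cost P s = instFeature P ⬝ᵥ ((1 : Matrix (Idx n k) (Idx n k) ℝ) *ᵥ solFeature k s)) ∧
    -- variance of the solution features under the uniform distribution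
    (∀ (n k : ℕ) (v : Idx n k → ℝ),
      cubeVar (fun s : Cube n => v ⬝ᵥ solFeature k s) =
        ∑ S : Idx n k with S.1 ≠ ∅, v S ^ 2) ∧
    ∃ c : ℕ, ∀ k : ℕ, ∃ C : ℝ, 0 < C ∧ ∀ n : ℕ, 1 ≤ n → ∀ ε : ℝ, 0 < ε →
      ∃ (i j l : ℕ) (lam β ρ η : ℝ),
        -- the fixed scalars, and their bit sizes
        lam = (1 / 2) ^ i ∧ β = (1 / 2) ^ j ∧ ρ = (1 / 2) ^ l ∧ 1 ≤ j ∧ 1 ≤ l ∧ 0 < η ∧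
        ((i + j + l : ℕ) : ℝ) ≤ C * Real.logb 2 ((n : ℝ) ^ k * (2 + 1 / ε)) ∧
        -- compressed: number of parameters, bits at each relative precision
        (Fintype.card (Idx n k) : ℝ) ≤ C * (n : ℝ) ^ k ∧
        ∃ wbar ∈ paramSpace n k lam,
        (∀ δ : ℝ, 0 < δ → δ ≤ 1 → ∃ b : ℕ,
          (b : ℝ) ≤ C * (n : ℝ) ^ k * Real.logb 2 (2 / δ) ∧
          Describable (paramSpace n k lam) wbar (δ / lam) b) ∧
        ∀ R : PMF (Instance n k),
          -- effect of the precision on the loss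
          (∀ δ : ℝ, 0 ≤ δ → ∀ w ∈ paramSpace n k lam, ∀ v ∈ paramSpace n k lam,
            (∀ S, |w S - v S| ≤ δ / lam) →
            |loss β ρ R w - loss β ρ R v| ≤ C * ((n : ℝ) ^ k * (1 + 1 / ε)) ^ c * δ) ∧
          -- the estimator of SGD is unbiased for the gradient of the regularized loss
          (∀ w : Param n k,
            HasGradientAt (regLoss lam β ρ R)
              (∑ ξ, sampleProb β ρ R w ξ • sgdGrad lam ρ w ξ) w) ∧
          -- complete
          loss β ρ R wbar ≤ opt R + ε ∧
          (∀ v ∈ paramSpace n k lam, regLoss lam β ρ R wbar ≤ regLoss lam β ρ R v) ∧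
          -- efficiently optimizable by projected SGD
          (∀ w₀ ∈ paramSpace n k lam, ∀ T : ℕ,
              C * ((n : ℝ) ^ k * (1 + 1 / ε)) ^ c ≤ (T : ℝ) →
              sgdAverage lam β ρ η R (loss β ρ R) T w₀ ≤ loss β ρ R wbar + ε ∧
              sgdAverage lam β ρ η R (regLoss lam β ρ R) T w₀ ≤
                regLoss lam β ρ R wbar + ε) := by
  refine ⟨fun n k P s => cost_eq_bilinear P s, fun n k v => cubeVar_dot_solFeature v, 29,
    fun k => ?_⟩
  obtain ⟨A, hA⟩ : ∃ A : ℝ, A = (k + 1) * 2 ^ 2 ^ k := ⟨_, rfl⟩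
  have hA1 : 1 ≤ A := by
    rw [hA]
    exact one_le_mul_of_one_le_of_one_le (by linarith [(Nat.cast_nonneg k : (0 : ℝ) ≤ k)])
      (one_le_pow₀ (by norm_num))
  have hC : 256 * A ≤ (16 * A) ^ 29 := by
    calc 256 * A ≤ (16 * A) ^ 2 := by nlinarith
      _ ≤ (16 * A) ^ 29 := pow_le_pow_right₀ (by linarith) (by norm_num)
  -- The number of SGD steps decides the constant: `K ≤ 8 * A * N ≤ 16 * A * n ^ k * (1 + 1 / ε)`,
  -- and `K ^ 29` steps suffice.
  refine ⟨(16 * A) ^ 29, by positivity, fun n hn ε hε => ?_⟩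
  have hn1 : (1 : ℝ) ≤ (n : ℝ) ^ k := one_le_pow₀ (by exact_mod_cast hn)
  have hd := card_idx_le_mul_pow hn k
  have hM := card_predicate_le_mul_pow hn k
  rw [← hA] at hd hM
  have hε1 : 0 < 1 / ε := by positivity
  -- The summand 2 gives `N ≥ 2`, so that `logb 2 N ≥ 1` absorbs additive constants.
  set N : ℝ := (n : ℝ) ^ k * (2 + 1 / ε) with hN
  have hN2 : 2 ≤ N := by nlinarith
  have hNn : (n : ℝ) ^ k ≤ N := by nlinarith
  have hNε : (n : ℝ) ^ k ≤ N * ε := by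
    have : N * ε = (n : ℝ) ^ k * (2 * ε + 1) := by rw [hN]; field_simp
    rw [this]
    nlinarith
  have hNB : N ≤ 2 * ((n : ℝ) ^ k * (1 + 1 / ε)) := by rw [hN]; nlinarith
  obtain ⟨q, hq1, hq2, hq3⟩ := exists_two_pow hA1 hN2
  obtain ⟨K, hKq⟩ : ∃ K : ℝ, K = 2 ^ q := ⟨_, rfl⟩
  rw [← hKq] at hq1 hq2
  have hK : 8 ≤ K := by nlinarith
  have hAn : A * (n : ℝ) ^ k ≤ K / 4 := by
    have := mul_le_mul_of_nonneg_left hNn (by linarith : 0 ≤ A)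
    linarith
  have hAnε : A * (n : ℝ) ^ k ≤ K * ε / 4 := by
    have h1 := mul_le_mul_of_nonneg_left hNε (by linarith : 0 ≤ A)
    have h2 := mul_le_mul_of_nonneg_right hq1 hε.le
    linarith
  have hKB : K ^ 29 ≤ (16 * A) ^ 29 * ((n : ℝ) ^ k * (1 + 1 / ε)) ^ 29 := by
    rw [← mul_pow]
    refine pow_le_pow_left₀ (by linarith) ?_ 29
    have := mul_le_mul_of_nonneg_left hNB (by linarith : 0 ≤ 8 * A)
    linarith
  have hlog : 1 ≤ Real.logb 2 N := by
    rw [Real.le_logb_iff_rpow_le (by norm_num) (by linarith), Real.rpow_one]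
    exact hN2
  have hlam : (1 / 2 : ℝ) ^ q = 1 / K := by rw [hKq, one_div_pow]
  have hq : 1 ≤ q := by
    by_contra h
    have : q = 0 := by omega
    rw [this, pow_zero] at hKq
    linarith
  have hl : 0 < 1 / K := by positivity
  have hl1 : 1 / K ≤ 1 := by rw [div_le_one (by linarith)]; linarith
  have hρ : 0 < (1 / K) ^ 3 := by positivity
  have hρ1 : (1 / K) ^ 3 ≤ 1 := pow_le_one₀ hl.le hl1
  -- Here `lam = β = 1 / K` and `ρ = lam ^ 3`, so `i + j + l = 5 * q`.
  refine ⟨q, q, q * 3, 1 / K, 1 / K, (1 / K) ^ 3, (1 / K) ^ 17, hlam.symm, hlam.symm, ?_, hq,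
    by omega, by positivity, ?_, ?_, refParam n k (1 / K), refParam_mem hl, ?_, fun R =>
      ⟨?_, hasGradientAt_regLoss _ _ _ R, ?_, fun v _ =>
        regLoss_refParam_le hl hl.le hl1 hρ R v, ?_⟩⟩
  · rw [pow_mul, hlam]
  · push_cast
    nlinarith
  · refine hd.trans (mul_le_mul_of_nonneg_right ?_ (by linarith))
    linarith
  · intro δ hδ hδ1
    obtain ⟨b, hb, hdesc⟩ := exists_describable hl hδ hδ1 (refParam_mem (n := n) (k := k) hl)
    refine ⟨b, hb.trans ?_, hdesc⟩
    refine mul_le_mul_of_nonneg_right ?_ (Real.logb_nonneg (by norm_num) ?_)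
    · calc 6 * (Fintype.card (Idx n k) : ℝ) ≤ 6 * (A * (n : ℝ) ^ k) := by linarith
        _ = 6 * A * (n : ℝ) ^ k := by ring
        _ ≤ _ := mul_le_mul_of_nonneg_right (by linarith) (by linarith)
    · rw [le_div_iff₀ hδ]
      linarith
  · intro δ hδ w _ v _ h
    refine (abs_loss_sub_le_pow hK (hd.trans hAn) (hM.trans hAn) hρ.le hρ1 hδ R h).trans ?_
    refine mul_le_mul_of_nonneg_right (le_trans ?_ hKB) hδ
    exact pow_le_pow_right₀ (by linarith) (by norm_num)
  · exact loss_refParam_le_add hε hK (hd.trans hAnε) (hM.trans hAnε) _ R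
  · intro w₀ hw₀ T hT
    exact sgd_guarantee hε hK (hd.trans hAn) (hM.trans hAn) (hd.trans hAnε) R hw₀ (hKB.trans hT)
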